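/- Let $A=(a_{ij})$ be a symmetrizable generalized Cartan matrix with rows and columns indexed by $S=\{1,\dots,n\}$, and let $\mathfrak h$ be the Cartan subalgebra of the associated complex Kac–Moody algebra, i.e. $(\mathfrak h,\{\alpha_i\},\{\alpha_i^\vee\})$ is a realization of $A$: the simple roots $\alpha_i\in\mathfrak h^*$ are linearly independent, the simple coroots $\alpha_i^\vee\in\mathfrak h$ are linearly independent, $\alpha_j(\alpha_i^\vee)=a_{ij}$, and $\dim\mathfrak h=2n-\operatorname{rank}A$. Fix $\rho\in\mathfrak h^*$ with $\rho(\alpha_i^\vee)=1$ for all $i$. Let $s_i\nu=\nu-\nu(\alpha_i^\vee)\alpha_i$ be the simple reflections of $\mathfrak h^*$ and, for $I\subseteq S$, let $W_I$ be the group generated by $\{s_i: i\in I\}$, with length function $\ell$. Let $\mathcal P$ be the set of pairs $(\lambda,I)$ with $\lambda\in\mathfrak h^*$, $I\subseteq S$ and $\lambda(\alpha_i^\vee)\in\mathbb Z_{\ge 0}$ for all $i\in I$, and let $\mathcal C$ be the set of $(\lambda,I)\in\mathcal P$ such that $I$ is nonempty and connected (the subgraph of the Dynkin diagram induced by $I$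 is connected). For $(\lambda,I)\in\mathcal P$ put $$U(\lambda,I)=e^{-\lambda}\sum_{w\in W_I}(-1)^{\ell(w)}e^{w(\lambda+\rho)-\rho},\qquad L(\lambda,I)=-\log U(\lambda,I),$$ where $U(\lambda,I)$ is regarded as a formal power series with constant term $1$ in the variables $e^{-\alpha_i}$, $i\in S$. Write $(\lambda,I)\approx(\mu,J)$ if $I=J$ and $\lambda(\alpha_i^\vee)=\mu(\alpha_i^\vee)$ for all $i\in I$. Fix an equivalence relation $\sim$ on $S$, write $[i]$ for the class of $i$, and let $$\pi:\mathbb Q[[e^{-\alpha_i}: i\in S]]\to\mathbb Q[[e^{-\gamma_{[i]}}: [i]\in S/{\sim}]]$$ be the specialization $e^{-\alpha_i}\mapsto e^{-\gamma_{[i]}}$. Call $\lambda\in\mathfrak h^*$ symmetric if $\lambda(\alpha_i^\vee)=\lambda(\alpha_j^\vee)$ whenever $i\sim j$. Let $K\subseteq S$ be a union of equivalence classes. A lift of $K$ is a connected subset of $K$ that meets every equivalence class contained in $K$; $K$ is equiconnected if it has a lift $\widehat K$ such that $|\bar K\cap E|\ge|\widehat K\cap E|$ for every lift $\bar K$ of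 $K$ and every equivalence class $E$. Let $\bar{\mathcal C}$ be the set of $(\lambda,I)\in\mathcal C$ such that $\lambda$ is symmetric and $I$ is an equiconnected union of equivalence classes. **Theorem.** Let $r,s\ge 0$ and let $(\lambda_1,I_1),\dots,(\lambda_r,I_r)$ and $(\mu_1,J_1),\dots,(\mu_s,J_s)$ be (not necessarily distinct) elements of $\bar{\mathcal C}$. The following are equivalent: 1. $\sum_{k=1}^r L(\lambda_k,I_k)=\sum_{k=1}^s L(\mu_k,J_k)$; 2. $\sum_{k=1}^r \pi(L(\lambda_k,I_k))=\sum_{k=1}^s \pi(L(\mu_k,J_k))$; 3. $r=s$ and there exists a permutation $\sigma\in\mathfrak S_r$ such that $(\lambda_k,I_k)\approx(\mu_{\sigma(k)},J_{\sigma(k)})$ for all $k$. -/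

import Mathlib

open Module

/-- A generalized Cartan matrix (GCM) with rows and columns indexed by `S = Fin n`. -/
structure GCM (n : ℕ) where
  /-- the underlying integer matrix -/
  toMatrix : Matrix (Fin n) (Fin n) ℤ
  diag : ∀ i, toMatrix i i = 2
  offDiag : ∀ i j, i ≠ j → toMatrix i j ≤ 0
  zero_iff : ∀ i j, toMatrix i j = 0 ↔ toMatrix j i = 0

namespace GCM

variable {n : ℕ}

/-- `A` is symmetrizable: `D A` is symmetric for some diagonal matrix `D` with positive real
diagonal entries. -/
def Symmetrizable (A : GCM n) : Prop :=
  ∃ d : Fin n → ℝ, (∀ i, 0 < d i) ∧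
    (Matrix.diagonal d * A.toMatrix.map (Int.cast : ℤ → ℝ)).IsSymm

/-- The graph underlying the Dynkin diagram of `A`: distinct nodes `i`, `j` are joined if and only
if `a_{ij} ≠ 0`. -/
def dynkinGraph (A : GCM n) : SimpleGraph (Fin n) where
  Adj i j := i ≠ j ∧ A.toMatrix i j ≠ 0
  symm := ⟨fun i j h => ⟨h.1.symm, fun h0 => h.2 ((A.zero_iff i j).2 h0)⟩⟩
  loopless := ⟨fun _ h => h.1 rfl⟩

/-- A set of nodes is connected if the subgraph of the Dynkin diagram induced by it is connected.
With this convention the empty set is connected; nonemptiness is required separately. -/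
def IsConnected (A : GCM n) (I : Set (Fin n)) : Prop :=
  (A.dynkinGraph.induce I).Preconnected

/-- `K` is a union of equivalence classes of `~`. -/
def IsUnionOfClasses (r : Setoid (Fin n)) (K : Set (Fin n)) : Prop :=
  ∀ i j, r i j → i ∈ K → j ∈ K

/-- `L` is a lift of `K` (for `K` a union of equivalence classes): a connected subset of `K` that
meets every equivalence class contained in `K`. -/
def IsLift (A : GCM n) (r : Setoid (Fin n)) (K L : Set (Fin n)) : Prop :=
  L ⊆ K ∧ A.IsConnected L ∧ ∀ i ∈ K, ∃ j ∈ L, r i j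

/-- `L` is a lean lift of `K`: among all lifts of `K` it has the fewest elements in every
equivalence class. -/
def IsLeanLift (A : GCM n) (r : Setoid (Fin n)) (K L : Set (Fin n)) : Prop :=
  A.IsLift r K L ∧ ∀ M, A.IsLift r K M → ∀ i : Fin n,
    (L ∩ {j | r i j}).ncard ≤ (M ∩ {j | r i j}).ncard

/-- `K` is equiconnected: it has a lean lift. -/
def IsEquiconnected (A : GCM n) (r : Setoid (Fin n)) (K : Set (Fin n)) : Prop :=
  ∃ L, A.IsLeanLift r K L

/-- A realization of `A` over `ℂ`: the Cartan subalgebra `𝔥` of the Kac-Moody algebra of `A`, with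
its simple roots `α_i ∈ 𝔥^*` and simple coroots `α_i^∨ ∈ 𝔥`. Both families are linearly
independent, `α_j (α_i^∨) = a_{ij}`, and `dim 𝔥 = 2 n - rank A`. -/
structure Realization (A : GCM n) (𝔥 : Type*) [AddCommGroup 𝔥] [Module ℂ 𝔥] where
  /-- the simple root `α_i` -/
  root : Fin n → Dual ℂ 𝔥
  /-- the simple coroot `α_i^∨` -/
  coroot : Fin n → 𝔥
  root_linearIndependent : LinearIndependent ℂ root
  coroot_linearIndependent : LinearIndependent ℂ coroot
  root_coroot : ∀ i j, root j (coroot i) = (A.toMatrix i j : ℂ)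
  finiteDimensional : FiniteDimensional ℂ 𝔥
  finrank_add_rank : finrank ℂ 𝔥 + (A.toMatrix.map (Int.cast : ℤ → ℂ)).rank = 2 * n

namespace Realization

variable {A : GCM n} {𝔥 : Type*} [AddCommGroup 𝔥] [Module ℂ 𝔥] (R : A.Realization 𝔥)

theorem eval_coroot_root (i : Fin n) : Dual.eval ℂ 𝔥 (R.coroot i) (R.root i) = 2 := by
  simp [R.root_coroot, A.diag]

/-- The simple reflection `s_i ν = ν - ν (α_i^∨) α_i` of `𝔥^*`. -/
noncomputable def simpleReflection (i : Fin n) : Dual ℂ 𝔥 ≃ₗ[ℂ] Dual ℂ 𝔥 :=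
  Module.reflection (R.eval_coroot_root i)

theorem simpleReflection_apply (i : Fin n) (ν : Dual ℂ 𝔥) :
    R.simpleReflection i ν = ν - ν (R.coroot i) • R.root i := by
  simp [simpleReflection, Module.reflection_apply]

/-- The parabolic subgroup `W_I` of the Weyl group. -/
def weylSubgroup (I : Set (Fin n)) : Subgroup (Dual ℂ 𝔥 ≃ₗ[ℂ] Dual ℂ 𝔥) :=
  Subgroup.closure (R.simpleReflection '' I)

/-- The length `ℓ(w)` of `w ∈ W_I`: the least `k` such that `w` is a product of `k` simple
reflections `s_i` with `i ∈ I`. -/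
noncomputable def length (I : Set (Fin n)) (w : Dual ℂ 𝔥 ≃ₗ[ℂ] Dual ℂ 𝔥) : ℕ :=
  sInf {k | ∃ l : List (Fin n), l.length = k ∧ (∀ i ∈ l, i ∈ I) ∧
    (l.map R.simpleReflection).prod = w}

/-- The integrability `J_λ`: the nodes `i` for which `λ (α_i^∨)` is a non-negative integer. -/
def integrability (lam : Dual ℂ 𝔥) : Set (Fin n) :=
  {i | ∃ m : ℕ, lam (R.coroot i) = m}

/-- The set `𝒫` of pairs `(λ, I)` with `I ⊆ J_λ`. -/
def pairs : Set (Dual ℂ 𝔥 × Set (Fin n)) :=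
  {p | p.2 ⊆ R.integrability p.1}

/-- The set `𝒞` of pairs `(λ, I) ∈ 𝒫` with `I` connected and nonempty. -/
def connectedPairs : Set (Dual ℂ 𝔥 × Set (Fin n)) :=
  {p | p ∈ R.pairs ∧ A.IsConnected p.2 ∧ p.2.Nonempty}

/-- `λ` is symmetric: `λ (α_i^∨) = λ (α_j^∨)` whenever `i ~ j`. -/
def IsSymmetric (r : Setoid (Fin n)) (lam : Dual ℂ 𝔥) : Prop :=
  ∀ i j, r i j → lam (R.coroot i) = lam (R.coroot j)

/-- The set of pairs `(λ, I) ∈ 𝒞` with `λ` symmetric and `I` an equiconnected union of equivalence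
classes. -/
def symmetricPairs (r : Setoid (Fin n)) : Set (Dual ℂ 𝔥 × Set (Fin n)) :=
  {p | p ∈ R.connectedPairs ∧ R.IsSymmetric r p.1 ∧ IsUnionOfClasses r p.2 ∧
    A.IsEquiconnected r p.2}

/-- `(λ, I) ≈ (μ, J)`: `I = J`, and `λ` and `μ` agree on `α_i^∨` for all `i ∈ I`. -/
def Approx (p q : Dual ℂ 𝔥 × Set (Fin n)) : Prop :=
  p.2 = q.2 ∧ ∀ i ∈ p.2, p.1 (R.coroot i) = q.1 (R.coroot i)

/-- The coefficient of `e^ν`, for `ν ∈ 𝔥^*`, in the normalised Weyl numerator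
`e^{-λ} ∑_{w ∈ W_I} (-1)^{ℓ(w)} e^{w(λ + ρ) - ρ}`. -/
noncomputable def weylNumeratorCoeff (ρ : Dual ℂ 𝔥) (p : Dual ℂ 𝔥 × Set (Fin n))
    (ν : Dual ℂ 𝔥) : ℚ :=
  ∑ᶠ w ∈ {w | w ∈ R.weylSubgroup p.2 ∧ w (p.1 + ρ) - ρ - p.1 = ν}, (-1 : ℚ) ^ R.length p.2 w

/-- The normalised Weyl numerator `U(λ, I)` as a formal power series in the variables
`x_i = e^{-α_i}`: the coefficient at `m` is that of `e^{- ∑ m_i α_i}`. -/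
noncomputable def weylNumerator (ρ : Dual ℂ 𝔥) (p : Dual ℂ 𝔥 × Set (Fin n)) :
    MvPowerSeries (Fin n) ℚ :=
  fun m => R.weylNumeratorCoeff ρ p (-∑ i, m i • R.root i)

/-- `L(λ, I) = - log U(λ, I)`; here `PowerSeries.log ℚ` is the series `log (1 + X)`. -/
noncomputable def negLogNumerator (ρ : Dual ℂ 𝔥) (p : Dual ℂ 𝔥 × Set (Fin n)) :
    MvPowerSeries (Fin n) ℚ :=
  -(PowerSeries.log ℚ).subst (R.weylNumerator ρ p - 1)

end Realization

/-- The specialization `π : ℚ[[e^{-α_i}]] → ℚ[[e^{-γ_[i]}]]` sending `e^{-α_i}` to `e^{-γ_[i]}`,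
with one variable `e^{-γ_c}` for each equivalence class `c` of `~`. -/
noncomputable def specialization (r : Setoid (Fin n)) :
    MvPowerSeries (Fin n) ℚ →ₐ[ℚ] MvPowerSeries (Quotient r) ℚ :=
  MvPowerSeries.rename (Quotient.mk r)

end GCM

/-! Attach to a pair $(\lambda,I)$ its label $d$, where $d_i=\lambda(\alpha_i^\vee)+1$ on $I$ and
$d_i=0$ elsewhere. On pairs, $\approx$ is equality of labels, and $W_I$ fixes any weight that
vanishes on the coroots of $I$, so $U$ and $L$ depend only on the label. This gives 3 ⇒ 1, and 1 ⇒ 2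
is linearity of $\pi$. The content is 2 ⇒ 3: the specialized logarithms determine the multiplicity
of every label.

Three facts about the exponents $m$ of $L(\lambda,I)$ are needed. Each nonzero $m_i$ has $i\in I$
and $m_i\ge d_i$ (`coeff_negLogNumerator_ne_zero`). The support of $m$ is connected
(`isConnected_support_of_coeff_negLogNumerator_ne_zero`), because the coefficients of $U$ multiply
over mutually orthogonal supports. The coefficient at $d|_K$ is positive for $K\subseteq I$ nonempty
and connected (`coeff_label_negLogNumerator_pos`): at the exponents $d|_J$, $U$ has the coefficients
of the signed independence polynomial of the Dynkin graph, and the corresponding coefficients of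
$-\log$ can be compared with those of that polynomial. All three pass from $U$ to $L$ through the
Euler identity for $-\log$ (`sum_antidiagonal_negLog`).

Now take $p=(\lambda,I)$ with label $d$ and a lean lift $K$ of $I$, and test at the image of $d|_K$
under $\pi$. If $q=(\mu,J)$ with label $d'$ contributes through an exponent $m$, then $I\subseteq
J$. If $I=J$, then $\operatorname{supp} m$ is a lift of $I$, so on each class $E\subseteq I$, with
$d_E,d'_E$ the common label values, $|K\cap E|\,d_E=\sum_{j\in E}m_j\ge|\operatorname{supp} m\cap
E|\,d'_E\ge|K\cap E|\,d'_E$, whence $d'\le d$. The matrix of test coefficients is therefore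
triangular for the order "larger support first, then smaller total". On its diagonal the
inequalities are equalities, so every contributing $m$ is the label restricted to a lift; its
coefficient is positive and nothing cancels. Induction along the order
(`card_label_eq_of_sum_specialization_eq`) finishes the proof. -/

namespace MvPowerSeries

/-! ### Logarithms of multivariate power series and the Euler identity. -/

variable {σ : Type*}

theorem coeff_pow_eq_zero_of_degree_lt {R : Type*} [CommRing R] {a : MvPowerSeries σ R}
    (ha : constantCoeff a = 0) {m : σ →₀ ℕ} {d : ℕ} (h : m.degree < d) : coeff m (a ^ d) = 0 := by
  apply coeff_of_lt_order
  refine lt_of_lt_of_le ?_ (le_order_pow_of_constantCoeff_eq_zero d ha)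
  exact_mod_cast h

/-- The chain rule for the substitution of a multivariate power series in a power series. -/
theorem pderiv_subst {R : Type*} [CommRing R] {f : PowerSeries R} {a : MvPowerSeries σ R}
    (ha : constantCoeff a = 0) (i : σ) :
    pderiv R i (f.subst a) = (PowerSeries.derivative R f).subst a * pderiv R i a := by
  have hs : PowerSeries.HasSubst a := PowerSeries.HasSubst.of_constantCoeff_zero ha
  -- As `a` has no constant term, a coefficient of a substitution sees only a truncation of the
  -- series. This reduces the chain rule to polynomials.
  have key : ∀ (g h : PowerSeries R) (m : σ →₀ ℕ) (N : ℕ), m.degree < N →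
      (∀ d < N, PowerSeries.coeff d g = PowerSeries.coeff d h) →
      coeff m (g.subst a) = coeff m (h.subst a) := by
    intro g h m N hN hgh
    rw [PowerSeries.coeff_subst hs, PowerSeries.coeff_subst hs]
    refine finsum_congr fun d => ?_
    by_cases hd : d < N
    · rw [hgh d hd]
    · rw [coeff_pow_eq_zero_of_degree_lt ha (by omega), smul_zero, smul_zero]
  have hcoe : ∀ p : Polynomial R, pderiv R i ((p : PowerSeries R).subst a) =
      (PowerSeries.derivative R (p : PowerSeries R)).subst a * pderiv R i a := by
    intro p
    simp [PowerSeries.subst_coe hs, PowerSeries.derivative_coe, Derivation.comp_aeval_eq (a := a)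
      (pderiv R i) p, smul_eq_mul]
  classical
  ext m
  -- The truncation must reach past degree `m.degree + 1`, since differentiation lowers degrees by
  -- one on both sides.
  set N := m.degree + 3 with hN
  rw [coeff_pderiv, key f (PowerSeries.trunc N f : Polynomial R) (m + Finsupp.single i 1) N
    (by simp [hN]) (fun d hd => (PowerSeries.coeff_coe_trunc_of_lt hd).symm), ← coeff_pderiv, hcoe,
    coeff_mul, coeff_mul]
  refine Finset.sum_congr rfl fun x hx => ?_
  congr 1
  have hx' : x.1.degree ≤ m.degree := by
    rw [← Finset.HasAntidiagonal.mem_antidiagonal.1 hx, map_add]; omega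
  refine (key _ _ x.1 (N - 1) (by omega) fun d hd => ?_).symm
  rw [PowerSeries.coeff_derivative, PowerSeries.coeff_derivative,
    PowerSeries.coeff_coe_trunc_of_lt (by omega)]

theorem coeff_X_mul_pderiv (f : MvPowerSeries σ ℚ) (i : σ) (m : σ →₀ ℕ) :
    coeff m (X i * pderiv ℚ i f) = m i * coeff m f := by
  classical
  by_cases h : Finsupp.single i 1 ≤ m
  · obtain ⟨k, rfl⟩ := exists_add_of_le h
    rw [X, coeff_add_monomial_mul, coeff_pderiv]
    simp [add_comm, mul_comm]
  · rw [X, coeff_monomial_mul, if_neg h]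
    have : m i = 0 := by simpa using h
    simp [this]

/-- The negative logarithm of a power series with constant term `1`. -/
noncomputable def negLog (f : MvPowerSeries σ ℚ) : MvPowerSeries σ ℚ :=
  -(PowerSeries.log ℚ).subst (f - 1)

theorem mul_pderiv_negLog {f : MvPowerSeries σ ℚ} (hf : constantCoeff f = 1) (i : σ) :
    f * pderiv ℚ i (negLog f) = -pderiv ℚ i f := by
  have h0 : constantCoeff (f - 1) = 0 := by simp [hf]
  have hs : PowerSeries.HasSubst (f - 1) := PowerSeries.HasSubst.of_constantCoeff_zero h0
  have h1 : ((1 : PowerSeries ℚ) + PowerSeries.X) * PowerSeries.derivative ℚ (PowerSeries.log ℚ)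
      = 1 := by
    ext k
    rw [PowerSeries.deriv_log, add_mul, one_mul, map_add]
    cases k with
    | zero => simp
    | succ k => rw [PowerSeries.coeff_succ_X_mul]; simp [pow_succ]
  have h2 := congrArg (PowerSeries.substAlgHom hs) h1
  rw [map_mul, map_add, map_one, PowerSeries.substAlgHom_X, PowerSeries.coe_substAlgHom,
    add_sub_cancel] at h2
  rw [negLog, map_neg, pderiv_subst h0, mul_neg, ← mul_assoc, h2, one_mul, map_sub, pderiv_one,
    sub_zero]

theorem constantCoeff_negLog {f : MvPowerSeries σ ℚ} (hf : constantCoeff f = 1) :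
    constantCoeff (negLog f) = 0 := by
  rw [negLog, map_neg, PowerSeries.constantCoeff_subst_eq_zero (by simp [hf]) _ (by simp), neg_zero]

/-- The coefficient form of $f\cdot x_i\partial_i(-\log f)=-x_i\partial_i f$. It computes the
coefficients of $-\log f$ recursively, and every later statement about them rests on it. -/
theorem sum_antidiagonal_negLog [DecidableEq σ] {f : MvPowerSeries σ ℚ} (hf : constantCoeff f = 1)
    (i : σ) (m : σ →₀ ℕ) :
    ∑ x ∈ Finset.HasAntidiagonal.antidiagonal m, coeff x.1 f * (x.2 i * coeff x.2 (negLog f)) =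
      -(m i * coeff m f) := by
  rw [← coeff_X_mul_pderiv, ← map_neg, ← mul_neg, ← mul_pderiv_negLog hf, mul_left_comm, coeff_mul]
  simp_rw [coeff_X_mul_pderiv]

end MvPowerSeries

/-! ### Words in the simple reflections and dihedral subgroups. -/

namespace GCM.Realization

variable {n : ℕ} {A : GCM n} {𝔥 : Type*} [AddCommGroup 𝔥] [Module ℂ 𝔥] (R : A.Realization 𝔥)

/-- The product of simple reflections spelled by a word. -/
noncomputable def wordProd (l : List (Fin n)) : Dual ℂ 𝔥 ≃ₗ[ℂ] Dual ℂ 𝔥 :=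
  (l.map R.simpleReflection).prod

@[simp] theorem wordProd_nil : R.wordProd [] = 1 := rfl

@[simp] theorem wordProd_cons (i : Fin n) (l : List (Fin n)) :
    R.wordProd (i :: l) = R.simpleReflection i * R.wordProd l := by
  simp [wordProd]

@[simp] theorem wordProd_append (l l' : List (Fin n)) :
    R.wordProd (l ++ l') = R.wordProd l * R.wordProd l' := by
  simp [wordProd]

@[simp] theorem simpleReflection_mul_self (i : Fin n) :
    R.simpleReflection i * R.simpleReflection i = 1 := by
  ext1 ν
  exact Module.involutive_reflection (R.eval_coroot_root i) ν

@[simp] theorem simpleReflection_mul_cancel_left (i : Fin n) (w : Dual ℂ 𝔥 ≃ₗ[ℂ] Dual ℂ 𝔥) :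
    R.simpleReflection i * (R.simpleReflection i * w) = w := by
  rw [← mul_assoc, simpleReflection_mul_self, one_mul]

theorem wordProd_reverse (l : List (Fin n)) : R.wordProd l.reverse = (R.wordProd l)⁻¹ := by
  induction l with
  | nil => simp
  | cons i l ih =>
    rw [List.reverse_cons, wordProd_append, ih, wordProd_cons, wordProd_nil, mul_one,
      wordProd_cons, mul_inv_rev, ← eq_inv_of_mul_eq_one_left (R.simpleReflection_mul_self i)]

theorem wordProd_mem {I : Set (Fin n)} {l : List (Fin n)} (hl : ∀ i ∈ l, i ∈ I) :
    R.wordProd l ∈ R.weylSubgroup I := by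
  refine Subgroup.list_prod_mem _ fun x hx => ?_
  obtain ⟨i, hi, rfl⟩ := List.mem_map.1 hx
  exact Subgroup.subset_closure ⟨i, hl i hi, rfl⟩

theorem exists_wordProd_eq {I : Set (Fin n)} {w : Dual ℂ 𝔥 ≃ₗ[ℂ] Dual ℂ 𝔥}
    (hw : w ∈ R.weylSubgroup I) : ∃ l : List (Fin n), (∀ i ∈ l, i ∈ I) ∧ R.wordProd l = w := by
  induction hw using Subgroup.closure_induction with
  | mem x hx =>
    obtain ⟨i, hi, rfl⟩ := hx
    exact ⟨[i], by simpa using hi, by simp⟩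
  | one => exact ⟨[], by simp, rfl⟩
  | mul x y _ _ hx hy =>
    obtain ⟨l, hl, rfl⟩ := hx
    obtain ⟨l', hl', rfl⟩ := hy
    refine ⟨l ++ l', fun i hi => ?_, R.wordProd_append l l'⟩
    exact (List.mem_append.1 hi).elim (hl i) (hl' i)
  | inv x _ hx =>
    obtain ⟨l, hl, rfl⟩ := hx
    exact ⟨l.reverse, by simpa using hl, R.wordProd_reverse l⟩

theorem length_wordProd_le {I : Set (Fin n)} {l : List (Fin n)} (hl : ∀ i ∈ l, i ∈ I) :
    R.length I (R.wordProd l) ≤ l.length :=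
  Nat.sInf_le ⟨l, rfl, hl, rfl⟩

theorem exists_reduced_word {I : Set (Fin n)} {w : Dual ℂ 𝔥 ≃ₗ[ℂ] Dual ℂ 𝔥}
    (hw : w ∈ R.weylSubgroup I) :
    ∃ l : List (Fin n), (∀ i ∈ l, i ∈ I) ∧ R.wordProd l = w ∧ l.length = R.length I w := by
  have hne : {k | ∃ l : List (Fin n), l.length = k ∧ (∀ i ∈ l, i ∈ I) ∧
      (l.map R.simpleReflection).prod = w}.Nonempty := by
    obtain ⟨l, hl, h⟩ := R.exists_wordProd_eq hw
    exact ⟨_, l, rfl, hl, h⟩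
  obtain ⟨l, h1, h2, h3⟩ := Nat.sInf_mem hne
  exact ⟨l, h2, h3, h1⟩

/-! ### Rank two -/

theorem simpleReflection_plane_left {i j : Fin n} (ν : Dual ℂ 𝔥) (a b : ℂ) :
    R.simpleReflection i (ν + a • R.root i + b • R.root j) =
      ν + (-ν (R.coroot i) - a - A.toMatrix i j * b) • R.root i + b • R.root j := by
  rw [simpleReflection_apply]
  simp only [LinearMap.add_apply, LinearMap.smul_apply, R.root_coroot, A.diag, smul_eq_mul]
  push_cast
  module

theorem simpleReflection_plane_right {i j : Fin n} (ν : Dual ℂ 𝔥) (a b : ℂ) :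
    R.simpleReflection j (ν + a • R.root i + b • R.root j) =
      ν + a • R.root i + (-ν (R.coroot j) - b - A.toMatrix j i * a) • R.root j := by
  rw [add_right_comm, simpleReflection_plane_left, add_right_comm]

/-- The alternating word of length `k` in `i` and `j` with last letter `j`. -/
def altWord (i j : Fin n) : ℕ → List (Fin n)
  | 0 => []
  | k + 1 => (if Even k then j else i) :: altWord i j k

/-- Neither the product of the word `x` in `i` and `j` nor its product with `s_i` is spelled by a
shorter word in `i` and `j`. -/
def IsShortest (i j : Fin n) (x : List (Fin n)) : Prop :=
  ∀ y : List (Fin n), (∀ k ∈ y, k = i ∨ k = j) →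
    (R.wordProd y = R.wordProd x ∨ R.wordProd y = R.wordProd x * R.simpleReflection i) →
      x.length ≤ y.length

variable {R} in
theorem IsShortest.of_cons {i j k : Fin n} {x : List (Fin n)} (hk : k = i ∨ k = j)
    (h : R.IsShortest i j (k :: x)) : R.IsShortest i j x := by
  intro y hy h'
  have := h (k :: y) (by simpa [hk] using hy) (by
    rcases h' with h' | h'
    · left; rw [wordProd_cons, wordProd_cons, h']
    · right; rw [wordProd_cons, wordProd_cons, h', mul_assoc])
  simpa using this

variable {R} in
-- Two equal adjacent letters cancel, and a final `i` is removed by multiplying with `s_i` on the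
-- right. Hence the letters alternate and the last one is `j`.
theorem IsShortest.eq_altWord {i j : Fin n} {x : List (Fin n)} (hx : ∀ k ∈ x, k = i ∨ k = j)
    (h : R.IsShortest i j x) : x = altWord i j x.length := by
  induction x with
  | nil => rfl
  | cons k x ih =>
    have hk := hx k (by simp)
    have hx' : ∀ k ∈ x, k = i ∨ k = j := fun l hl => hx l (by simp [hl])
    have ih := ih hx' (h.of_cons hk)
    rw [List.length_cons, altWord, ← ih]
    congr 1
    by_contra hne
    rcases x with _ | ⟨l, x⟩
    · have hki : k = i := by simpa [altWord, show k ≠ j by simpa using hne] using hk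
      subst hki
      simpa using h [] (by simp) (Or.inr (by simp))
    · have hl : l = if Even x.length then j else i := by
        rw [List.length_cons, altWord] at ih
        exact (List.cons.inj ih).1
      have hkl : k = l := by
        simp only [List.length_cons, Nat.even_add_one] at hne
        by_cases he : Even x.length
        · simp only [he, not_true_eq_false, if_false, if_true] at hl hne
          rw [hl]; exact hk.resolve_left hne
        · simp only [he, not_false_eq_true, if_false, if_true] at hl hne
          rw [hl]; exact hk.resolve_right hne
      subst hkl
      have := h x (fun m hm => hx' m (by simp [hm])) (Or.inl (by simp))
      simp at this

theorem isShortest_altWord_of_le {i j : Fin n} {k m : ℕ} (hkm : k ≤ m)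
    (h : R.IsShortest i j (altWord i j m)) : R.IsShortest i j (altWord i j k) := by
  induction m, hkm using Nat.le_induction with
  | base => exact h
  | succ m _ ih =>
    refine ih (IsShortest.of_cons ?_ h)
    split_ifs <;> simp

/-- The last clause is the induction invariant: the coefficient about to be reflected is at most
half of what makes its reflection vanish. Reflection then does not decrease it, and
$a_{ij}a_{ji}\ge4$ transfers the bound to the other coefficient. -/
theorem wordProd_altWord_root_of_four_le {i j : Fin n}
    (hij : A.toMatrix i j ≤ 0) (hji : A.toMatrix j i ≤ 0)
    (h4 : 4 ≤ A.toMatrix i j * A.toMatrix j i) (k : ℕ) :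
    ∃ a b : ℤ, 0 ≤ a ∧ 0 ≤ b ∧
      R.wordProd (altWord i j k) (R.root i) = (a : ℂ) • R.root i + (b : ℂ) • R.root j ∧
      if Even k then 2 * b ≤ -A.toMatrix j i * a else 2 * a ≤ -A.toMatrix i j * b := by
  induction k with
  | zero => exact ⟨1, 0, by simp, by simp, by simp [altWord], by simpa using hji⟩
  | succ k ih =>
    obtain ⟨a, b, ha, hb, hv, hinv⟩ := ih
    have hl := R.simpleReflection_plane_left (i := i) (j := j) 0 a b
    have hr := R.simpleReflection_plane_right (i := i) (j := j) 0 a b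
    simp only [zero_add, LinearMap.zero_apply, neg_zero, zero_sub] at hl hr
    rw [altWord]
    by_cases he : Even k
    · simp only [he, if_true] at hinv
      refine ⟨a, -b - A.toMatrix j i * a, ha, by linarith, ?_, ?_⟩
      · rw [if_pos he, wordProd_cons, LinearEquiv.mul_apply, hv, hr]
        push_cast; rfl
      · rw [if_neg (by simpa [Nat.even_add_one] using he)]
        nlinarith [mul_nonneg (sub_nonneg.2 h4) ha, mul_nonneg (neg_nonneg.2 hij) (sub_nonneg.2 hinv)]
    · simp only [he, if_false] at hinv
      refine ⟨-a - A.toMatrix i j * b, b, by linarith, hb, ?_, ?_⟩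
      · rw [if_neg he, wordProd_cons, LinearEquiv.mul_apply, hv, hl]
        push_cast; rfl
      · rw [if_pos (by simpa [Nat.even_add_one] using he)]
        nlinarith [mul_nonneg (sub_nonneg.2 h4) hb, mul_nonneg (neg_nonneg.2 hji) (sub_nonneg.2 hinv)]

/-- A braid relation shortening the alternating word of length `m` times `s_i` bounds the length of
the shortest words; this leaves finitely many cases when the dihedral group is finite. -/
theorem lt_of_isShortest_altWord {i j : Fin n} {k m : ℕ} (h : R.IsShortest i j (altWord i j k))
    {y : List (Fin n)} (hy : ∀ k ∈ y, k = i ∨ k = j)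
    (hprod : R.wordProd y = R.wordProd (altWord i j m) * R.simpleReflection i)
    (hlen : y.length < (altWord i j m).length) : k < m := by
  by_contra hk
  exact absurd (R.isShortest_altWord_of_le (not_lt.1 hk) h y hy (Or.inr hprod)) (by omega)

set_option maxHeartbeats 1000000 in
/-- The image of `α_i` under a shortest word in the dihedral group of `i` and `j` is a nonnegative
combination of `α_i` and `α_j`. -/
theorem exists_wordProd_root_eq {i j : Fin n} (hij : i ≠ j) {x : List (Fin n)}
    (hx : ∀ k ∈ x, k = i ∨ k = j) (h : R.IsShortest i j x) :
    ∃ a b : ℕ, R.wordProd x (R.root i) = a • R.root i + b • R.root j := by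
  suffices H : ∃ a b : ℤ, 0 ≤ a ∧ 0 ≤ b ∧
      R.wordProd x (R.root i) = (a : ℂ) • R.root i + (b : ℂ) • R.root j by
    obtain ⟨a, b, ha, hb, hv⟩ := H
    lift a to ℕ using ha
    lift b to ℕ using hb
    exact ⟨a, b, by simpa [Nat.cast_smul_eq_nsmul] using hv⟩
  have hp := A.offDiag i j hij
  have hq := A.offDiag j i hij.symm
  have hxk := h.eq_altWord hx
  generalize x.length = k at hxk
  subst hxk
  by_cases h4 : 4 ≤ A.toMatrix i j * A.toMatrix j i
  · obtain ⟨a, b, ha, hb, hv, -⟩ := R.wordProd_altWord_root_of_four_le hp hq h4 k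
    exact ⟨a, b, ha, hb, hv⟩
  -- The finite types $A_1\times A_1$, $A_2$, $B_2$, $G_2$, the last two in both orientations.
  -- Below, the braid relation of length 2, 3, 4 or 6 bounds `k`, and the remaining images of
  -- $\alpha_i$ are listed.
  have hcases : (A.toMatrix i j = 0 ∧ A.toMatrix j i = 0) ∨
      (A.toMatrix i j = -1 ∧ A.toMatrix j i = -1) ∨ (A.toMatrix i j = -1 ∧ A.toMatrix j i = -2) ∨
      (A.toMatrix i j = -2 ∧ A.toMatrix j i = -1) ∨ (A.toMatrix i j = -1 ∧ A.toMatrix j i = -3) ∨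
      (A.toMatrix i j = -3 ∧ A.toMatrix j i = -1) := by
    have hz := A.zero_iff i j
    generalize A.toMatrix i j = a at *
    generalize A.toMatrix j i = b at *
    by_cases ha : a = 0
    · exact Or.inl ⟨ha, hz.1 ha⟩
    have hb : b ≠ 0 := fun hb => ha (hz.2 hb)
    have ha' : a ≤ -1 := by omega
    have hb' : b ≤ -1 := by omega
    have ha3 : -3 ≤ a := by nlinarith
    have hb3 : -3 ≤ b := by nlinarith
    interval_cases a <;> interval_cases b <;> simp_all
  have hl := R.simpleReflection_plane_left (i := i) (j := j)
  have hr := R.simpleReflection_plane_right (i := i) (j := j)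
  have hl0 := fun a b => hl 0 a b
  have hr0 := fun a b => hr 0 a b
  have hroot : R.root i = (1 : ℂ) • R.root i + (0 : ℂ) • R.root j := by simp
  simp only [zero_add, LinearMap.zero_apply, neg_zero, zero_sub] at hl0 hr0
  -- The zero multiples put a generic vector into the shape that the plane formulas `hl` and `hr`
  -- rewrite.
  have ext_of : ∀ w w' : Dual ℂ 𝔥 ≃ₗ[ℂ] Dual ℂ 𝔥,
      (∀ ν, w (ν + (0 : ℂ) • R.root i + (0 : ℂ) • R.root j) =
        w' (ν + (0 : ℂ) • R.root i + (0 : ℂ) • R.root j)) → w = w' := by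
    intro w w' hw
    ext1 ν
    simpa using hw ν
  have act : ∀ (x : List (Fin n)) (a b : ℤ),
      R.wordProd x ((1 : ℂ) • R.root i + (0 : ℂ) • R.root j) = (a : ℂ) • R.root i + (b : ℂ) • R.root j →
      R.wordProd x (R.root i) = (a : ℂ) • R.root i + (b : ℂ) • R.root j := by
    intro x a b hw
    rw [← hw, ← hroot]
  rcases hcases with ⟨e1, e2⟩ | ⟨e1, e2⟩ | ⟨e1, e2⟩ | ⟨e1, e2⟩ | ⟨e1, e2⟩ | ⟨e1, e2⟩ <;>
    simp only [e1, e2] at hl hr hl0 hr0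
  · have hk : k < 2 := R.lt_of_isShortest_altWord (y := [j]) h (by simp)
      (ext_of _ _ fun ν => by
        rw [show altWord i j 2 = [i, j] from rfl]
        simp only [wordProd_cons, wordProd_nil, mul_one, LinearEquiv.mul_apply, hl, hr]
        push_cast
        module) (by simp [altWord])
    interval_cases k
    · exact ⟨1, 0, by simp, by simp, by simp [altWord]⟩
    · refine ⟨1, 0, by simp, by simp, act [j] _ _ ?_⟩
      simp only [wordProd_cons, wordProd_nil, mul_one, hr0]
      push_cast
      module
  · have hk : k < 3 := R.lt_of_isShortest_altWord (y := [i, j]) h (by simp)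
      (ext_of _ _ fun ν => by
        rw [show altWord i j 3 = [j, i, j] from rfl]
        simp only [wordProd_cons, wordProd_nil, mul_one, LinearEquiv.mul_apply, hl, hr]
        push_cast
        module) (by simp [altWord])
    interval_cases k
    · exact ⟨1, 0, by simp, by simp, by simp [altWord]⟩
    · refine ⟨1, 1, by simp, by simp, act [j] _ _ ?_⟩
      simp only [wordProd_cons, wordProd_nil, mul_one, hr0]
      push_cast
      module
    · refine ⟨0, 1, by simp, by simp, act [i, j] _ _ ?_⟩
      simp only [wordProd_cons, wordProd_nil, mul_one, LinearEquiv.mul_apply, hl0, hr0]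
      push_cast
      module
  · have hk : k < 4 := R.lt_of_isShortest_altWord (y := [j, i, j]) h (by simp)
      (ext_of _ _ fun ν => by
        rw [show altWord i j 4 = [i, j, i, j] from rfl]
        simp only [wordProd_cons, wordProd_nil, mul_one, LinearEquiv.mul_apply, hl, hr]
        push_cast
        module) (by simp [altWord])
    interval_cases k
    · exact ⟨1, 0, by simp, by simp, by simp [altWord]⟩
    · refine ⟨1, 2, by simp, by simp, act [j] _ _ ?_⟩
      simp only [wordProd_cons, wordProd_nil, mul_one, hr0]
      push_cast
      module
    · refine ⟨1, 2, by simp, by simp, act [i, j] _ _ ?_⟩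
      simp only [wordProd_cons, wordProd_nil, mul_one, LinearEquiv.mul_apply, hl0, hr0]
      push_cast
      module
    · refine ⟨1, 0, by simp, by simp, act [j, i, j] _ _ ?_⟩
      simp only [wordProd_cons, wordProd_nil, mul_one, LinearEquiv.mul_apply, hl0, hr0]
      push_cast
      module
  · have hk : k < 4 := R.lt_of_isShortest_altWord (y := [j, i, j]) h (by simp)
      (ext_of _ _ fun ν => by
        rw [show altWord i j 4 = [i, j, i, j] from rfl]
        simp only [wordProd_cons, wordProd_nil, mul_one, LinearEquiv.mul_apply, hl, hr]
        push_cast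
        module) (by simp [altWord])
    interval_cases k
    · exact ⟨1, 0, by simp, by simp, by simp [altWord]⟩
    · refine ⟨1, 1, by simp, by simp, act [j] _ _ ?_⟩
      simp only [wordProd_cons, wordProd_nil, mul_one, hr0]
      push_cast
      module
    · refine ⟨1, 1, by simp, by simp, act [i, j] _ _ ?_⟩
      simp only [wordProd_cons, wordProd_nil, mul_one, LinearEquiv.mul_apply, hl0, hr0]
      push_cast
      module
    · refine ⟨1, 0, by simp, by simp, act [j, i, j] _ _ ?_⟩
      simp only [wordProd_cons, wordProd_nil, mul_one, LinearEquiv.mul_apply, hl0, hr0]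
      push_cast
      module
  · have hk : k < 6 := R.lt_of_isShortest_altWord (y := [j, i, j, i, j]) h (by simp)
      (ext_of _ _ fun ν => by
        rw [show altWord i j 6 = [i, j, i, j, i, j] from rfl]
        simp only [wordProd_cons, wordProd_nil, mul_one, LinearEquiv.mul_apply, hl, hr]
        push_cast
        module) (by simp [altWord])
    interval_cases k
    · exact ⟨1, 0, by simp, by simp, by simp [altWord]⟩
    · refine ⟨1, 3, by simp, by simp, act [j] _ _ ?_⟩
      simp only [wordProd_cons, wordProd_nil, mul_one, hr0]
      push_cast
      module
    · refine ⟨2, 3, by simp, by simp, act [i, j] _ _ ?_⟩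
      simp only [wordProd_cons, wordProd_nil, mul_one, LinearEquiv.mul_apply, hl0, hr0]
      push_cast
      module
    · refine ⟨2, 3, by simp, by simp, act [j, i, j] _ _ ?_⟩
      simp only [wordProd_cons, wordProd_nil, mul_one, LinearEquiv.mul_apply, hl0, hr0]
      push_cast
      module
    · refine ⟨1, 3, by simp, by simp, act [i, j, i, j] _ _ ?_⟩
      simp only [wordProd_cons, wordProd_nil, mul_one, LinearEquiv.mul_apply, hl0, hr0]
      push_cast
      module
    · refine ⟨1, 0, by simp, by simp, act [j, i, j, i, j] _ _ ?_⟩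
      simp only [wordProd_cons, wordProd_nil, mul_one, LinearEquiv.mul_apply, hl0, hr0]
      push_cast
      module
  · have hk : k < 6 := R.lt_of_isShortest_altWord (y := [j, i, j, i, j]) h (by simp)
      (ext_of _ _ fun ν => by
        rw [show altWord i j 6 = [i, j, i, j, i, j] from rfl]
        simp only [wordProd_cons, wordProd_nil, mul_one, LinearEquiv.mul_apply, hl, hr]
        push_cast
        module) (by simp [altWord])
    interval_cases k
    · exact ⟨1, 0, by simp, by simp, by simp [altWord]⟩
    · refine ⟨1, 1, by simp, by simp, act [j] _ _ ?_⟩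
      simp only [wordProd_cons, wordProd_nil, mul_one, hr0]
      push_cast
      module
    · refine ⟨2, 1, by simp, by simp, act [i, j] _ _ ?_⟩
      simp only [wordProd_cons, wordProd_nil, mul_one, LinearEquiv.mul_apply, hl0, hr0]
      push_cast
      module
    · refine ⟨2, 1, by simp, by simp, act [j, i, j] _ _ ?_⟩
      simp only [wordProd_cons, wordProd_nil, mul_one, LinearEquiv.mul_apply, hl0, hr0]
      push_cast
      module
    · refine ⟨1, 1, by simp, by simp, act [i, j, i, j] _ _ ?_⟩
      simp only [wordProd_cons, wordProd_nil, mul_one, LinearEquiv.mul_apply, hl0, hr0]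
      push_cast
      module
    · refine ⟨1, 0, by simp, by simp, act [j, i, j, i, j] _ _ ?_⟩
      simp only [wordProd_cons, wordProd_nil, mul_one, LinearEquiv.mul_apply, hl0, hr0]
      push_cast
      module

end GCM.Realization

/-! ### Positivity of roots and the action on dominant weights. -/

namespace GCM.Realization

variable {n : ℕ} {A : GCM n} {𝔥 : Type*} [AddCommGroup 𝔥] [Module ℂ 𝔥] (R : A.Realization 𝔥)

theorem length_mul_wordProd_le {I : Set (Fin n)} {v : Dual ℂ 𝔥 ≃ₗ[ℂ] Dual ℂ 𝔥}
    (hv : v ∈ R.weylSubgroup I) {x : List (Fin n)} (hx : ∀ i ∈ x, i ∈ I) :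
    R.length I (v * R.wordProd x) ≤ R.length I v + x.length := by
  obtain ⟨l, hl, rfl, h⟩ := R.exists_reduced_word hv
  rw [← wordProd_append, ← h, ← List.length_append]
  exact R.length_wordProd_le fun i hi => (List.mem_append.1 hi).elim (hl i) (hx i)

/-- If `w` is not shortened by right multiplication with `s_i`, then `w α_i` is a nonnegative
combination of simple roots. -/
theorem exists_apply_root_eq {I : Set (Fin n)} {w : Dual ℂ 𝔥 ≃ₗ[ℂ] Dual ℂ 𝔥}
    (hw : w ∈ R.weylSubgroup I) {i : Fin n} (hi : i ∈ I)
    (hlen : R.length I w ≤ R.length I (w * R.simpleReflection i)) :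
    ∃ m : Fin n → ℕ, w (R.root i) = ∑ j, m j • R.root j := by
  classical
  induction hN : R.length I w using Nat.strong_induction_on generalizing w i with
  | _ N ih =>
  subst hN
  obtain ⟨l, hl, rfl, hll⟩ := R.exists_reduced_word hw
  rcases List.eq_nil_or_concat' l with rfl | ⟨l, j, rfl⟩
  · exact ⟨Pi.single i 1, by simp [Pi.single_apply]⟩
  set w := R.wordProd (l ++ [j]) with hwdef
  have hlI : ∀ k ∈ l, k ∈ I := fun k hk => hl k (by simp [hk])
  have hjI : j ∈ I := hl j (by simp)
  rw [List.length_append, List.length_singleton] at hll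
  have hlw : w * R.simpleReflection j = R.wordProd l := by
    rw [hwdef, wordProd_append, wordProd_cons, wordProd_nil, mul_one, mul_assoc,
      simpleReflection_mul_self, mul_one]
  have hlle := R.length_wordProd_le hlI
  have hij : i ≠ j := by
    rintro rfl
    rw [hlw] at hlen
    omega
  have hIij : ∀ y : List (Fin n), (∀ k ∈ y, k = i ∨ k = j) → ∀ k ∈ y, k ∈ I := by
    intro y hy k hk
    rcases hy k hk with rfl | rfl <;> assumption
  -- Factor $w=vx$ with lengths adding, $x$ a word in $i,j$ and $v$ as short as possible. Splitting
  -- off the last letter $j$ shows that $v$ is shorter than $w$. Minimality lets induction make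
  -- $v\alpha_i$ and $v\alpha_j$ nonnegative, and the rank two case handles $x\alpha_i$.
  have hex : ∃ N, ∃ v ∈ R.weylSubgroup I, ∃ x : List (Fin n), (∀ k ∈ x, k = i ∨ k = j) ∧
      w = v * R.wordProd x ∧ R.length I v + x.length = R.length I w ∧ R.length I v = N := by
    refine ⟨_, R.wordProd l, R.wordProd_mem hlI, [j], by simp, by simp [hwdef], ?_, rfl⟩
    have h1 := R.length_mul_wordProd_le (R.wordProd_mem hlI) (x := [j]) (by simpa using hjI)
    rw [← wordProd_append, ← hwdef] at h1
    simp only [List.length_singleton] at h1 ⊢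
    omega
  have hlt : Nat.find hex < R.length I w := by
    refine lt_of_le_of_lt (Nat.find_min' hex ⟨R.wordProd l, R.wordProd_mem hlI, [j], by simp,
      by simp [hwdef], ?_, rfl⟩) (by omega)
    have h1 := R.length_mul_wordProd_le (R.wordProd_mem hlI) (x := [j]) (by simpa using hjI)
    rw [← wordProd_append, ← hwdef] at h1
    simp only [List.length_singleton] at h1 ⊢
    omega
  obtain ⟨v, hv, x, hx, hwv, hlv, hvN⟩ := Nat.find_spec hex
  have hmin : ∀ t, t = i ∨ t = j → R.length I v ≤ R.length I (v * R.simpleReflection t) := by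
    intro t ht
    by_contra hlt'
    have htI : t ∈ I := by rcases ht with rfl | rfl <;> assumption
    have hv' : v * R.simpleReflection t ∈ R.weylSubgroup I :=
      mul_mem hv (Subgroup.subset_closure ⟨t, htI, rfl⟩)
    have hw' : w = v * R.simpleReflection t * R.wordProd (t :: x) := by
      rw [wordProd_cons, mul_assoc, simpleReflection_mul_cancel_left, hwv]
    have hx' : ∀ k ∈ t :: x, k = i ∨ k = j := by simpa [ht] using hx
    refine Nat.find_min hex (m := R.length I (v * R.simpleReflection t)) (by omega)
      ⟨_, hv', t :: x, hx', hw', ?_, rfl⟩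
    have h1 := R.length_mul_wordProd_le hv' (hIij _ hx')
    rw [← hw'] at h1
    simp only [List.length_cons] at h1 ⊢
    omega
  obtain ⟨mi, hmi⟩ := ih _ (by omega) hv hi (hmin i (Or.inl rfl)) rfl
  obtain ⟨mj, hmj⟩ := ih _ (by omega) hv hjI (hmin j (Or.inr rfl)) rfl
  obtain ⟨a, b, hab⟩ := R.exists_wordProd_root_eq hij hx fun y hy h => by
    have h1 := R.length_mul_wordProd_le hv (hIij _ hy)
    rcases h with h | h
    · rw [h, ← hwv] at h1
      omega
    · rw [h, ← mul_assoc, ← hwv] at h1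
      omega
  refine ⟨fun k => a * mi k + b * mj k, ?_⟩
  rw [hwv, LinearEquiv.mul_apply, hab, map_add, map_nsmul, map_nsmul, hmi, hmj]
  simp [add_smul, mul_smul, Finset.sum_add_distrib, Finset.smul_sum]

theorem exists_eq_mul_simpleReflection {I : Set (Fin n)} {w : Dual ℂ 𝔥 ≃ₗ[ℂ] Dual ℂ 𝔥}
    (hw : w ∈ R.weylSubgroup I) (h1 : w ≠ 1) :
    ∃ w' ∈ R.weylSubgroup I, ∃ i ∈ I, w = w' * R.simpleReflection i ∧
      R.length I w' < R.length I w ∧ ∃ m : Fin n → ℕ, w' (R.root i) = ∑ j, m j • R.root j := by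
  obtain ⟨l, hl, rfl, hll⟩ := R.exists_reduced_word hw
  rcases List.eq_nil_or_concat' l with rfl | ⟨l, i, rfl⟩
  · exact absurd rfl h1
  have hlI : ∀ k ∈ l, k ∈ I := fun k hk => hl k (by simp [hk])
  have hiI : i ∈ I := hl i (by simp)
  have hprod : R.wordProd (l ++ [i]) = R.wordProd l * R.simpleReflection i := by simp
  have hlle := R.length_wordProd_le hlI
  rw [List.length_append, List.length_singleton] at hll
  refine ⟨R.wordProd l, R.wordProd_mem hlI, i, hiI, hprod, by omega,
    R.exists_apply_root_eq (R.wordProd_mem hlI) hiI ?_⟩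
  rw [← hprod]
  omega

theorem sum_smul_root_injective {a b : Fin n → ℂ}
    (h : ∑ i, a i • R.root i = ∑ i, b i • R.root i) : a = b := by
  have h' : ∑ i, (a i - b i) • R.root i = 0 := by
    simp [sub_smul, Finset.sum_sub_distrib, h]
  funext i
  exact sub_eq_zero.1 (Fintype.linearIndependent_iff.1 R.root_linearIndependent _ h' i)

theorem sum_nsmul_root_injective {a b : Fin n → ℕ}
    (h : ∑ i, a i • R.root i = ∑ i, b i • R.root i) : a = b := by
  have := R.sum_smul_root_injective (a := fun i => (a i : ℂ)) (b := fun i => (b i : ℂ))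
    (by simpa [Nat.cast_smul_eq_nsmul] using h)
  funext i
  exact_mod_cast congrFun this i

theorem wordProd_apply_eq (l : List (Fin n)) (v : Dual ℂ 𝔥) :
    ∃ c : Fin n → ℂ, (∀ i ∉ l, c i = 0) ∧ R.wordProd l v = v - ∑ i, c i • R.root i := by
  classical
  induction l with
  | nil => exact ⟨0, by simp, by simp⟩
  | cons j l ih =>
    obtain ⟨c, hc, h⟩ := ih
    refine ⟨c + Pi.single j (R.wordProd l v (R.coroot j)), fun i hi => ?_, ?_⟩
    · rw [List.mem_cons, not_or] at hi
      simp [hc i hi.2, hi.1]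
    · rw [wordProd_cons, LinearEquiv.mul_apply, simpleReflection_apply]
      nth_rw 1 [h]
      simp [add_smul, Finset.sum_add_distrib, Pi.single_apply, sub_sub]

/-- Every element of `W_I` has a word `l` such that, for each weight `Λ` that is dominant integral
on `I`, the multiplicity of `α_i` in `Λ - w Λ` is at least `Λ(α_i^∨)` if `i` occurs in `l`, and `0`
otherwise. -/
theorem exists_word_forall_sub_apply {I : Set (Fin n)} {w : Dual ℂ 𝔥 ≃ₗ[ℂ] Dual ℂ 𝔥}
    (hw : w ∈ R.weylSubgroup I) :
    ∃ l : List (Fin n), (∀ i ∈ l, i ∈ I) ∧ R.wordProd l = w ∧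
      ∀ (Λ : Dual ℂ 𝔥) (d : Fin n → ℕ), (∀ i ∈ I, Λ (R.coroot i) = d i) →
        ∃ m : Fin n → ℕ, w Λ = Λ - ∑ i, m i • R.root i ∧ (∀ i ∉ l, m i = 0) ∧
          ∀ i ∈ l, d i ≤ m i := by
  classical
  induction hN : R.length I w using Nat.strong_induction_on generalizing w with
  | _ N ih =>
  subst hN
  by_cases h1 : w = 1
  · subst h1
    exact ⟨[], by simp, rfl, fun Λ d _ => ⟨0, by simp, by simp, by simp⟩⟩
  obtain ⟨w', hw', i, hi, rfl, hlt, k, hk⟩ := R.exists_eq_mul_simpleReflection hw h1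
  obtain ⟨l, hl, rfl, H⟩ := ih _ hlt hw' rfl
  refine ⟨l ++ [i], ?_, by simp, fun Λ d hd => ?_⟩
  · intro j hj
    rcases List.mem_append.1 hj with hj | hj
    · exact hl j hj
    · rw [List.mem_singleton.1 hj]; exact hi
  obtain ⟨m, hm, hm0, hmd⟩ := H Λ d hd
  obtain ⟨c, hc, hcv⟩ := R.wordProd_apply_eq l (R.root i)
  have hkc : ∀ j, j ∉ l → k j = if j = i then 1 else 0 := by
    intro j hj
    have h2 : ∑ j, (k j : ℂ) • R.root j = ∑ j, ((if j = i then 1 else 0) - c j) • R.root j := by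
      simp only [Nat.cast_smul_eq_nsmul, sub_smul, Finset.sum_sub_distrib, ← hk, hcv]
      simp
    have h3 := congrFun (R.sum_smul_root_injective h2) j
    rw [hc j hj, sub_zero] at h3
    split_ifs at h3 ⊢ <;> exact_mod_cast h3
  refine ⟨fun j => m j + d i * k j, ?_, fun j hj => ?_, fun j hj => ?_⟩
  · rw [LinearEquiv.mul_apply, simpleReflection_apply, hd i hi, map_sub, Nat.cast_smul_eq_nsmul,
      map_nsmul, hm, hk]
    simp [add_smul, mul_smul, Finset.sum_add_distrib, Finset.smul_sum, sub_sub]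
  · simp only [List.mem_append, List.mem_singleton, not_or] at hj
    simp [hm0 j hj.1, hkc j hj.1, hj.2]
  · by_cases hjl : j ∈ l
    · exact (hmd j hjl).trans (Nat.le_add_right _ _)
    · have hji : j = i := by simpa [hjl] using hj
      subst hji
      simp [hkc j hjl]

/-- A regular dominant weight has trivial stabilizer: any letter in the word of $w'^{-1}w$ would
subtract a positive multiple of a simple root. -/
theorem eq_of_apply_eq {I : Set (Fin n)} {w w' : Dual ℂ 𝔥 ≃ₗ[ℂ] Dual ℂ 𝔥}
    (hw : w ∈ R.weylSubgroup I) (hw' : w' ∈ R.weylSubgroup I) {Λ : Dual ℂ 𝔥} {d : Fin n → ℕ}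
    (hd : ∀ i ∈ I, Λ (R.coroot i) = d i) (hpos : ∀ i ∈ I, 0 < d i) (h : w Λ = w' Λ) : w = w' := by
  obtain ⟨l, hl, hlw, H⟩ := R.exists_word_forall_sub_apply (mul_mem (inv_mem hw') hw)
  obtain ⟨m, hm, -, hmd⟩ := H Λ d hd
  rw [LinearEquiv.mul_apply, h, ← LinearEquiv.mul_apply, inv_mul_cancel, LinearEquiv.coe_one,
    id_eq, eq_comm, sub_eq_self] at hm
  have hm0 : m = 0 := R.sum_nsmul_root_injective (by simpa using hm)
  have hl0 : l = [] := List.eq_nil_iff_forall_not_mem.2 fun i hi => by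
    have := hmd i hi
    have := hpos i (hl i hi)
    rw [hm0, Pi.zero_apply] at *
    omega
  rw [hl0, wordProd_nil] at hlw
  exact (inv_mul_eq_one.1 hlw.symm).symm

theorem det_simpleReflection (i : Fin n) :
    LinearMap.det (R.simpleReflection i : Dual ℂ 𝔥 →ₗ[ℂ] Dual ℂ 𝔥) = -1 := by
  have := R.finiteDimensional
  have h : (R.simpleReflection i : Dual ℂ 𝔥 →ₗ[ℂ] Dual ℂ 𝔥) =
      LinearMap.transvection (-Dual.eval ℂ 𝔥 (R.coroot i)) (R.root i) := by
    ext1 ν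
    rw [LinearEquiv.coe_coe, simpleReflection_apply, LinearMap.transvection.apply]
    simp [sub_eq_add_neg]
  rw [h, LinearMap.transvection.det, LinearMap.neg_apply, R.eval_coroot_root]
  norm_num

theorem det_wordProd (l : List (Fin n)) :
    LinearMap.det (R.wordProd l : Dual ℂ 𝔥 →ₗ[ℂ] Dual ℂ 𝔥) = (-1) ^ l.length := by
  induction l with
  | nil => exact LinearMap.det_id
  | cons i l ih =>
    have h : (R.wordProd (i :: l) : Dual ℂ 𝔥 →ₗ[ℂ] Dual ℂ 𝔥) =
        (R.simpleReflection i : Dual ℂ 𝔥 →ₗ[ℂ] Dual ℂ 𝔥) ∘ₗ R.wordProd l := by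
      ext1 ν; simp
    rw [h, LinearMap.det_comp, ih, det_simpleReflection, List.length_cons, pow_succ']

/-- Both sides are the determinant of the product, so the sign can be read off any word, reduced or
not. -/
theorem neg_one_pow_length {I : Set (Fin n)} {l : List (Fin n)} (hl : ∀ i ∈ l, i ∈ I) :
    (-1 : ℚ) ^ R.length I (R.wordProd l) = (-1) ^ l.length := by
  obtain ⟨l', -, h, hlen⟩ := R.exists_reduced_word (R.wordProd_mem hl)
  have h1 : ((-1 : ℂ)) ^ l'.length = (-1) ^ l.length := by
    rw [← R.det_wordProd, ← R.det_wordProd, h]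
  rw [← hlen]
  exact_mod_cast h1

end GCM.Realization

/-! ### Labels and the coefficients of the Weyl numerator. -/

namespace GCM.Realization

variable {n : ℕ} {A : GCM n} {𝔥 : Type*} [AddCommGroup 𝔥] [Module ℂ 𝔥] (R : A.Realization 𝔥)

open Classical in
/-- The labels `λ(α_i^∨) + 1` of a pair `(λ, I)` at the nodes `i ∈ I`, extended by zero. -/
noncomputable def label (p : Dual ℂ 𝔥 × Set (Fin n)) : Fin n →₀ ℕ :=
  Finsupp.equivFunOnFinite.symm fun i => if i ∈ p.2 then ⌊(p.1 (R.coroot i)).re⌋₊ + 1 else 0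

variable {R} {ρ : Dual ℂ 𝔥} {p q : Dual ℂ 𝔥 × Set (Fin n)}

theorem label_pos_iff {i : Fin n} : 0 < R.label p i ↔ i ∈ p.2 := by
  simp only [label, Finsupp.equivFunOnFinite_symm_apply_apply]
  split_ifs with h <;> simp [h]

theorem label_eq_zero_iff {i : Fin n} : R.label p i = 0 ↔ i ∉ p.2 := by
  rw [← label_pos_iff (R := R), Nat.pos_iff_ne_zero, not_not]

theorem cast_label (hp : p ∈ R.pairs) {i : Fin n} (hi : i ∈ p.2) :
    (R.label p i : ℂ) = p.1 (R.coroot i) + 1 := by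
  obtain ⟨m, hm⟩ := hp hi
  simp [label, hi, hm]

theorem add_apply_coroot (hρ : ∀ i, ρ (R.coroot i) = 1) (hp : p ∈ R.pairs) {i : Fin n}
    (hi : i ∈ p.2) : (p.1 + ρ) (R.coroot i) = R.label p i := by
  rw [cast_label hp hi, LinearMap.add_apply, hρ]

theorem approx_iff_label_eq (hp : p ∈ R.pairs) (hq : q ∈ R.pairs) :
    R.Approx p q ↔ R.label p = R.label q := by
  constructor
  · rintro ⟨h2, h⟩
    ext i
    by_cases hi : i ∈ p.2
    · have h3 : (R.label p i : ℂ) = R.label q i := by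
        rw [cast_label hp hi, cast_label hq (h2 ▸ hi), h i hi]
      exact_mod_cast h3
    · rw [label_eq_zero_iff.2 hi, label_eq_zero_iff.2 (h2 ▸ hi)]
  · intro h
    have h2 : p.2 = q.2 := by
      ext i
      rw [← label_pos_iff (R := R), h, label_pos_iff]
    refine ⟨h2, fun i hi => ?_⟩
    have := cast_label hp hi
    rw [h, cast_label hq (h2 ▸ hi)] at this
    exact (add_right_cancel this).symm

open MvPowerSeries

/-- Since $\lambda+\rho$ is regular dominant on $I$, a single element of $W_I$ contributes to each
exponent, so no terms cancel. -/
theorem coeff_weylNumerator_of_word (hρ : ∀ i, ρ (R.coroot i) = 1) (hp : p ∈ R.pairs)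
    {l : List (Fin n)} (hl : ∀ i ∈ l, i ∈ p.2) {m : Fin n →₀ ℕ}
    (h : R.wordProd l (p.1 + ρ) = p.1 + ρ - ∑ i, m i • R.root i) :
    coeff m (R.weylNumerator ρ p) = (-1) ^ l.length := by
  change R.weylNumeratorCoeff ρ p (-∑ i, m i • R.root i) = _
  have hset : {w | w ∈ R.weylSubgroup p.2 ∧ w (p.1 + ρ) - ρ - p.1 = -∑ i, m i • R.root i} =
      {R.wordProd l} := by
    ext w
    have he : w (p.1 + ρ) - ρ - p.1 = -∑ i, m i • R.root i ↔
        w (p.1 + ρ) = p.1 + ρ - ∑ i, m i • R.root i := by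
      rw [sub_sub, sub_eq_iff_eq_add, add_comm ρ, neg_add_eq_sub]
    rw [Set.mem_ofPred_eq, he, Set.mem_singleton_iff]
    refine ⟨fun hw => ?_, ?_⟩
    · exact R.eq_of_apply_eq hw.1 (R.wordProd_mem hl) (fun i hi => add_apply_coroot hρ hp hi)
        (fun i hi => label_pos_iff.2 hi) (hw.2.trans h.symm)
    · rintro rfl
      exact ⟨R.wordProd_mem hl, h⟩
  rw [weylNumeratorCoeff, hset, finsum_mem_singleton, R.neg_one_pow_length hl]

theorem exists_word_of_coeff_ne_zero (hρ : ∀ i, ρ (R.coroot i) = 1) (hp : p ∈ R.pairs)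
    {m : Fin n →₀ ℕ} (h : coeff m (R.weylNumerator ρ p) ≠ 0) :
    ∃ l : List (Fin n), (∀ i ∈ l, i ∈ p.2) ∧
      R.wordProd l (p.1 + ρ) = p.1 + ρ - ∑ i, m i • R.root i ∧ (∀ i ∉ l, m i = 0) ∧
        ∀ i ∈ l, R.label p i ≤ m i := by
  change R.weylNumeratorCoeff ρ p (-∑ i, m i • R.root i) ≠ 0 at h
  obtain ⟨w, ⟨hw, he⟩, -⟩ := exists_ne_zero_of_finsum_mem_ne_zero h
  obtain ⟨l, hl, rfl, H⟩ := R.exists_word_forall_sub_apply hw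
  obtain ⟨m', hm', h0, hd⟩ := H (p.1 + ρ) (R.label p) fun i hi => add_apply_coroot hρ hp hi
  rw [sub_sub, sub_eq_iff_eq_add, add_comm ρ, neg_add_eq_sub] at he
  have : m' = m := R.sum_nsmul_root_injective (by
    rw [he] at hm'
    exact (sub_right_injective hm').symm)
  subst this
  exact ⟨l, hl, hm', h0, hd⟩

theorem weylNumerator_congr (hρ : ∀ i, ρ (R.coroot i) = 1) (hp : p ∈ R.pairs) (hq : q ∈ R.pairs)
    (h : R.Approx p q) : R.weylNumerator ρ p = R.weylNumerator ρ q := by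
  have key : ∀ {p q : Dual ℂ 𝔥 × Set (Fin n)}, p ∈ R.pairs → q ∈ R.pairs → R.Approx p q →
      ∀ m, coeff m (R.weylNumerator ρ p) ≠ 0 →
        coeff m (R.weylNumerator ρ p) = coeff m (R.weylNumerator ρ q) := by
    intro p q hp hq h m hm
    obtain ⟨l, hl, hlm, -⟩ := exists_word_of_coeff_ne_zero hρ hp hm
    rw [coeff_weylNumerator_of_word hρ hp hl hlm,
      coeff_weylNumerator_of_word hρ hq (fun i hi => h.1 ▸ hl i hi)]
    -- The difference of the weights vanishes on the coroots of $I$, so $W_I$ fixes it and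
    -- $w(\lambda+\rho)-(\lambda+\rho)$ is unchanged.
    have hfix : ∀ l : List (Fin n), (∀ i ∈ l, i ∈ p.2) → R.wordProd l (q.1 - p.1) = q.1 - p.1 := by
      intro l hl
      induction l with
      | nil => rfl
      | cons i l ih =>
        rw [wordProd_cons, LinearEquiv.mul_apply, ih fun j hj => hl j (by simp [hj]),
          simpleReflection_apply, LinearMap.sub_apply, h.2 i (hl i (by simp))]
        simp
    have hsplit : q.1 + ρ = (p.1 + ρ) + (q.1 - p.1) := by abel
    rw [hsplit, map_add, hlm, hfix l hl]
    abel
  ext m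
  by_cases h1 : coeff m (R.weylNumerator ρ p) = 0
  · by_cases h2 : coeff m (R.weylNumerator ρ q) = 0
    · rw [h1, h2]
    · exact (key hq hp ⟨h.1.symm, fun i hi => (h.2 i (h.1 ▸ hi)).symm⟩ m h2).symm
  · exact key hp hq h m h1

theorem constantCoeff_weylNumerator (hρ : ∀ i, ρ (R.coroot i) = 1) (hp : p ∈ R.pairs) :
    constantCoeff (R.weylNumerator ρ p) = 1 := by
  rw [← coeff_zero_eq_constantCoeff_apply,
    coeff_weylNumerator_of_word hρ hp (l := []) (by simp) (by simp)]
  simp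

theorem coeff_weylNumerator_ne_zero (hρ : ∀ i, ρ (R.coroot i) = 1) (hp : p ∈ R.pairs)
    {m : Fin n →₀ ℕ} (h : coeff m (R.weylNumerator ρ p) ≠ 0) {i : Fin n} (hi : m i ≠ 0) :
    i ∈ p.2 ∧ R.label p i ≤ m i := by
  obtain ⟨l, hl, -, h0, hd⟩ := exists_word_of_coeff_ne_zero hρ hp h
  have hil : i ∈ l := by
    by_contra hil
    exact hi (h0 i hil)
  exact ⟨hl i hil, hd i hil⟩

theorem simpleReflection_root_of_eq_zero {i j : Fin n} (h : A.toMatrix i j = 0) :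
    R.simpleReflection i (R.root j) = R.root j := by
  simp [simpleReflection_apply, R.root_coroot, h]

theorem wordProd_sum_root_of_eq_zero {l : List (Fin n)} {b : Fin n → ℂ}
    (h : ∀ i ∈ l, ∀ j, b j ≠ 0 → A.toMatrix i j = 0) :
    R.wordProd l (∑ j, b j • R.root j) = ∑ j, b j • R.root j := by
  induction l with
  | nil => rfl
  | cons i l ih =>
    rw [wordProd_cons, LinearEquiv.mul_apply, ih fun k hk => h k (by simp [hk]), map_sum]
    refine Finset.sum_congr rfl fun j _ => ?_
    by_cases hb : b j = 0
    · simp [hb]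
    · rw [map_smul, simpleReflection_root_of_eq_zero (h i (by simp) j hb)]

theorem simpleReflection_commute {i j : Fin n} (h : A.toMatrix i j = 0) :
    Commute (R.simpleReflection i) (R.simpleReflection j) := by
  have h' := (A.zero_iff i j).1 h
  ext1 ν
  rw [LinearEquiv.mul_apply, LinearEquiv.mul_apply, R.simpleReflection_apply j ν,
    R.simpleReflection_apply i ν, map_sub, map_sub, map_smul, map_smul,
    simpleReflection_root_of_eq_zero h, simpleReflection_root_of_eq_zero h',
    R.simpleReflection_apply j ν, R.simpleReflection_apply i ν]
  abel

theorem wordProd_eq_mul_filter {l : List (Fin n)} {P : Fin n → Prop} [DecidablePred P]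
    (h : ∀ i ∈ l, ∀ j ∈ l, P i → ¬P j → A.toMatrix i j = 0) :
    R.wordProd l = R.wordProd (l.filter P) * R.wordProd (l.filter (¬P ·)) := by
  induction l with
  | nil => simp
  | cons k l ih =>
    have ih := ih fun i hi j hj => h i (by simp [hi]) j (by simp [hj])
    by_cases hk : P k
    · simp [hk, ih, mul_assoc]
    · have hc : Commute (R.simpleReflection k) (R.wordProd (l.filter P)) := by
        refine Commute.list_prod_right _ _ fun x hx => ?_
        obtain ⟨i, hi, rfl⟩ := List.mem_map.1 hx
        simp only [List.mem_filter, decide_eq_true_eq] at hi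
        exact (simpleReflection_commute (h i (by simp [hi.1]) k (by simp) hi.2 hk)).symm
      simp only [hk, decide_false, decide_true, not_false_eq_true, wordProd_cons, ih, Bool.false_eq_true,
        List.filter_cons_of_pos, List.filter_cons_of_neg]
      rw [← mul_assoc, hc.eq, mul_assoc]

/-- Reflections at unlinked nodes commute and fix each other's roots. A word realizing $a+b$
therefore sorts into one realizing $a$ and one realizing $b$; conversely two such words concatenate.
-/
theorem coeff_add_weylNumerator (hρ : ∀ i, ρ (R.coroot i) = 1) (hp : p ∈ R.pairs)
    {a b : Fin n →₀ ℕ} (hab : ∀ i j, a i ≠ 0 → b j ≠ 0 → A.toMatrix i j = 0) :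
    coeff (a + b) (R.weylNumerator ρ p) =
      coeff a (R.weylNumerator ρ p) * coeff b (R.weylNumerator ρ p) := by
  classical
  set Λ := p.1 + ρ with hΛ
  have hcast : ∀ m : Fin n →₀ ℕ, ∑ i, m i • R.root i = ∑ i, (m i : ℂ) • R.root i := by
    simp [Nat.cast_smul_eq_nsmul]
  by_cases h : coeff (a + b) (R.weylNumerator ρ p) = 0
  · by_contra hne
    rw [h, eq_comm, mul_eq_zero, not_or] at hne
    obtain ⟨l, hl, hlΛ, -, hla⟩ := exists_word_of_coeff_ne_zero hρ hp hne.1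
    obtain ⟨l', hl', hlΛ', -, -⟩ := exists_word_of_coeff_ne_zero hρ hp hne.2
    have hfix := wordProd_sum_root_of_eq_zero (R := R) (l := l) (b := fun i => (b i : ℂ))
      fun i hi j hj => hab i j
        (ne_of_gt (lt_of_lt_of_le (label_pos_iff.2 (hl i hi)) (hla i hi))) (by simpa using hj)
    have hll : R.wordProd (l ++ l') Λ = Λ - ∑ i, (a + b) i • R.root i := by
      rw [wordProd_append, LinearEquiv.mul_apply, hlΛ', map_sub, hlΛ, hcast b, hfix, ← hcast b]
      simp [hΛ, add_smul, Finset.sum_add_distrib, sub_sub]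
    rw [coeff_weylNumerator_of_word hρ hp (fun i hi => (List.mem_append.1 hi).elim (hl i) (hl' i))
      hll] at h
    exact pow_ne_zero _ (by norm_num) h
  · obtain ⟨l, hl, hlΛ, -, hlm⟩ := exists_word_of_coeff_ne_zero hρ hp h
    have hlab : ∀ i ∈ l, a i = 0 → b i ≠ 0 := by
      intro i hi ha hb
      have h1 := hlm i hi
      have h2 := label_pos_iff (R := R).2 (hl i hi)
      simp only [Finsupp.add_apply, ha, hb] at h1
      omega
    have hdis : ∀ i, a i = 0 ∨ b i = 0 := by
      intro i
      by_contra hi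
      rw [not_or] at hi
      have := hab i i hi.1 hi.2
      rw [A.diag] at this
      norm_num at this
    set l1 := l.filter (a · ≠ 0) with hl1
    set l2 := l.filter (¬ a · ≠ 0) with hl2
    have hprod : R.wordProd l = R.wordProd l1 * R.wordProd l2 :=
      wordProd_eq_mul_filter fun i _ j hj hi hj' => hab i j hi (hlab j hj (not_not.1 hj'))
    have hlen : l.length = l1.length + l2.length := by
      simp only [hl1, hl2, ← List.countP_eq_length_filter]
      simpa using l.length_eq_countP_add_countP (fun i => decide (a i ≠ 0))
    have hmem1 : ∀ i ∈ l1, i ∈ l ∧ a i ≠ 0 := by simp [hl1]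
    have hmem2 : ∀ i ∈ l2, i ∈ l ∧ a i = 0 := by simp [hl2]
    obtain ⟨c1, hc1, h1⟩ := R.wordProd_apply_eq l1 Λ
    obtain ⟨c2, hc2, h2⟩ := R.wordProd_apply_eq l2 Λ
    have hc1a : ∀ i, a i = 0 → c1 i = 0 := fun i hi => hc1 i fun hil => (hmem1 i hil).2 hi
    have hc2b : ∀ i, b i = 0 → c2 i = 0 := fun i hi => hc2 i fun hil =>
      hlab i (hmem2 i hil).1 (hmem2 i hil).2 hi
    have hsum : ∑ i, (c1 i + c2 i) • R.root i = ∑ i, ((a + b) i : ℂ) • R.root i := by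
      rw [hprod, LinearEquiv.mul_apply, h2, map_sub, h1, wordProd_sum_root_of_eq_zero
        fun i hi j hj => hab i j (hmem1 i hi).2 fun hb => hj (hc2b j hb), hcast (a + b), sub_sub,
        ← Finset.sum_add_distrib] at hlΛ
      simpa [add_smul] using sub_right_injective hlΛ
    have hcoef := fun i => congrFun (R.sum_smul_root_injective hsum) i
    have ha : ∀ i, c1 i = a i := by
      intro i
      have := hcoef i
      rcases hdis i with h0 | h0
      · rw [hc1a i h0, h0, Nat.cast_zero]
      · simpa [hc2b i h0, h0] using this
    have hb : ∀ i, c2 i = b i := by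
      intro i
      have := hcoef i
      rcases hdis i with h0 | h0
      · simpa [hc1a i h0, h0] using this
      · rw [hc2b i h0, h0, Nat.cast_zero]
    rw [coeff_weylNumerator_of_word hρ hp hl hlΛ,
      coeff_weylNumerator_of_word hρ hp (l := l1) (fun i hi => hl i (hmem1 i hi).1)
        (by rw [hcast, ← hΛ, h1]; simp only [ha]),
      coeff_weylNumerator_of_word hρ hp (l := l2) (fun i hi => hl i (hmem2 i hi).1)
        (by rw [hcast, ← hΛ, h2]; simp only [hb]), hlen, pow_add]

theorem coeff_single_label_weylNumerator (hρ : ∀ i, ρ (R.coroot i) = 1) (hp : p ∈ R.pairs)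
    {i : Fin n} (hi : i ∈ p.2) :
    coeff (Finsupp.single i (R.label p i)) (R.weylNumerator ρ p) = -1 := by
  classical
  rw [coeff_weylNumerator_of_word hρ hp (l := [i]) (by simpa using hi)]
  · simp
  · rw [wordProd_cons, wordProd_nil, mul_one, simpleReflection_apply, add_apply_coroot hρ hp hi]
    simp [Finsupp.single_apply, Nat.cast_smul_eq_nsmul]

theorem coeff_label_weylNumerator_of_indep (hρ : ∀ i, ρ (R.coroot i) = 1) (hp : p ∈ R.pairs)
    {J : Finset (Fin n)} (hJ : ∀ i ∈ J, i ∈ p.2)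
    (hind : ∀ i ∈ J, ∀ j ∈ J, i ≠ j → A.toMatrix i j = 0) :
    coeff ((R.label p).filter (· ∈ J)) (R.weylNumerator ρ p) = (-1) ^ J.card := by
  classical
  induction J using Finset.induction_on with
  | empty =>
    have : (R.label p).filter (· ∈ (∅ : Finset (Fin n))) = 0 := by ext; simp
    rw [this, coeff_zero_eq_constantCoeff_apply, constantCoeff_weylNumerator hρ hp]
    simp
  | insert i J hi ih =>
    have hsplit : (R.label p).filter (· ∈ insert i J) =
        Finsupp.single i (R.label p i) + (R.label p).filter (· ∈ J) := by
      ext j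
      by_cases hj : j = i
      · subst hj; simp [hi]
      · simp [Finsupp.filter_apply, hj]
    rw [hsplit, coeff_add_weylNumerator hρ hp, ih (fun j hj => hJ j (by simp [hj]))
      (fun j hj k hk => hind j (by simp [hj]) k (by simp [hk])),
      coeff_single_label_weylNumerator hρ hp (hJ i (by simp)), Finset.card_insert_of_notMem hi,
      pow_succ']
    intro j k hj hk
    have hj' : j = i := by
      by_contra h
      simp [Ne.symm h] at hj
    have hk' : k ∈ J := by
      by_contra h
      simp [h] at hk
    subst hj'
    exact hind j (by simp) k (by simp [hk']) fun h => hi (h ▸ hk')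

/-- Write $w=w's_i$. The exponent leaves so little room that $w'$ must fix $\alpha_i$ and realize
the label on $J\setminus\{i\}$; fixing $\alpha_i$ then forces $i$ to be unlinked to
$J\setminus\{i\}$. -/
theorem indep_of_coeff_label_ne_zero (hρ : ∀ i, ρ (R.coroot i) = 1) (hp : p ∈ R.pairs)
    {J : Finset (Fin n)} {w : Dual ℂ 𝔥 ≃ₗ[ℂ] Dual ℂ 𝔥} (hw : w ∈ R.weylSubgroup p.2)
    (hJ : ∀ i ∈ J, i ∈ p.2)
    (h : w (p.1 + ρ) = p.1 + ρ - ∑ i, (R.label p).filter (· ∈ J) i • R.root i) :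
    ∀ i ∈ J, ∀ j ∈ J, i ≠ j → A.toMatrix i j = 0 := by
  classical
  induction hN : J.card generalizing J w with
  | zero => simp [Finset.card_eq_zero.1 hN]
  | succ N ih =>
  set Λ := p.1 + ρ with hΛ
  have hdom : ∀ i ∈ p.2, Λ (R.coroot i) = R.label p i := fun i hi => add_apply_coroot hρ hp hi
  have hw1 : w ≠ 1 := by
    rintro rfl
    rw [LinearEquiv.coe_one, id_eq, eq_comm, sub_eq_self] at h
    have h0 := R.sum_nsmul_root_injective (b := 0) (by simpa using h)
    obtain ⟨i, hi⟩ := Finset.card_pos.1 (show 0 < J.card by omega)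
    have := congrFun h0 i
    simp only [Finsupp.filter_apply_pos (· ∈ J) _ hi, Pi.zero_apply] at this
    exact (label_eq_zero_iff.1 this) (hJ i hi)
  obtain ⟨w', hw', i, hi, rfl, -, k, hk⟩ := R.exists_eq_mul_simpleReflection hw hw1
  obtain ⟨l, hl, hlw, H⟩ := R.exists_word_forall_sub_apply hw'
  obtain ⟨m, hm, hm0, hmd⟩ := H Λ _ hdom
  have hsum : ∀ j, m j + R.label p i * k j = (R.label p).filter (· ∈ J) j := by
    refine congrFun (R.sum_nsmul_root_injective ?_)
    rw [LinearEquiv.mul_apply, simpleReflection_apply, hdom i hi, map_sub, Nat.cast_smul_eq_nsmul,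
      map_nsmul, hm, hk, sub_sub] at h
    simpa [add_smul, mul_smul, Finset.sum_add_distrib, Finset.smul_sum]
      using sub_right_injective h
  have hlpos : ∀ j ∈ p.2, 0 < R.label p j := fun j hj => label_pos_iff.2 hj
  -- A letter $j$ of $w'$ already uses up the whole exponent $d_j$, so $w'\alpha_i$ cannot involve
  -- $\alpha_j$.
  have hlJ : ∀ j ∈ l, j ∈ J ∧ m j = R.label p j ∧ k j = 0 := by
    intro j hj
    have h1 := hsum j
    have h2 := hmd j hj
    have h3 := hlpos j (hl j hj)
    by_cases hjJ : j ∈ J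
    · rw [Finsupp.filter_apply_pos (· ∈ J) _ hjJ] at h1
      have h4 : R.label p i * k j = 0 := by omega
      exact ⟨hjJ, by omega, (mul_eq_zero.1 h4).resolve_left (hlpos i hi).ne'⟩
    · rw [Finsupp.filter_apply_neg (· ∈ J) _ hjJ] at h1
      omega
  obtain ⟨c, hc, hcv⟩ := R.wordProd_apply_eq l (R.root i)
  have hkc : ∀ j, (k j : ℂ) = (if j = i then 1 else 0) - c j := by
    have h2 : ∑ j, (k j : ℂ) • R.root j = ∑ j, ((if j = i then 1 else 0) - c j) • R.root j := by
      simp only [Nat.cast_smul_eq_nsmul, sub_smul, Finset.sum_sub_distrib, ← hk, ← hlw, hcv]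
      simp
    exact fun j => congrFun (R.sum_smul_root_injective h2) j
  have hil : i ∉ l := by
    intro hil
    have hk0 : ∀ j, k j = 0 := by
      intro j
      by_cases hj : j ∈ l
      · exact (hlJ j hj).2.2
      · have h1 := hkc j
        rw [hc j hj, if_neg (fun e : j = i => hj (e ▸ hil)), sub_zero] at h1
        exact_mod_cast h1
    have h1 : w' (R.root i) = 0 := by simp [hk, hk0]
    exact R.root_linearIndependent.ne_zero i ((LinearEquiv.map_eq_zero_iff w').1 h1)
  have hki : ∀ j, k j = if j = i then 1 else 0 := by
    intro j
    by_cases hj : j ∈ l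
    · rw [(hlJ j hj).2.2, if_neg (fun e : j = i => hil (e ▸ hj))]
    · have h1 := hkc j
      rw [hc j hj, sub_zero] at h1
      split_ifs at h1 ⊢ <;> exact_mod_cast h1
  have hiJ : i ∈ J := by
    by_contra hiJ
    have h1 := hsum i
    rw [Finsupp.filter_apply_neg (· ∈ J) _ hiJ, hki i, if_pos rfl] at h1
    have := hlpos i hi
    omega
  have hfix : w' (R.root i) = R.root i := by simp [hk, hki]
  have hmJ : ∀ j, m j = (R.label p).filter (· ∈ J.erase i) j := by
    intro j
    have h1 := hsum j
    by_cases hj : j = i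
    · subst hj
      rw [hm0 j hil, Finsupp.filter_apply_neg _ _ (by simp)]
    · rw [hki, if_neg hj, mul_zero, add_zero] at h1
      rw [h1]
      simp [Finsupp.filter_apply, hj]
  have ih := ih hw' (J := J.erase i) (fun j hj => hJ j (Finset.mem_of_mem_erase hj))
    (by rw [hm]; simp only [hmJ]) (by rw [Finset.card_erase_of_mem hiJ, hN]; rfl)
  have hwJ : w' ∈ R.weylSubgroup (J.erase i : Finset (Fin n)) := by
    rw [← hlw]
    refine R.wordProd_mem fun j hj => ?_
    simpa using ⟨(hlJ j hj).1, fun e : j = i => hil (e ▸ hj)⟩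
  obtain ⟨l', hl', -, H'⟩ := R.exists_word_forall_sub_apply hwJ
  obtain ⟨m', hm', hm0', -⟩ := H' Λ (R.label p) fun j hj =>
    hdom j (hJ j (Finset.mem_of_mem_erase hj))
  have hmm' : m' = m := R.sum_nsmul_root_injective (sub_right_injective (hm'.symm.trans hm))
  -- The weight $-\alpha_i$ is dominant on $J\setminus\{i\}$, with values $-a_{ji}\ge0$. Since $w'$
  -- fixes it, these values vanish at every letter, and the letters exhaust $J\setminus\{i\}$.
  obtain ⟨e, he, -, hed⟩ := H' (-R.root i) (fun j => (-A.toMatrix j i).toNat) fun j hj => by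
    rw [LinearMap.neg_apply, R.root_coroot]
    have h1 : A.toMatrix j i ≤ 0 := A.offDiag j i (Finset.ne_of_mem_erase hj)
    have h2 : (((-A.toMatrix j i).toNat : ℤ) : ℂ) = ((-A.toMatrix j i : ℤ) : ℂ) := by
      rw [Int.toNat_of_nonneg (by omega)]
    rw [← Int.cast_neg, ← h2, Int.cast_natCast]
  have he0 : e = 0 := R.sum_nsmul_root_injective (by
    rw [map_neg, hfix, eq_comm, sub_eq_self] at he
    simpa using he)
  have hzero : ∀ j ∈ J, j ≠ i → A.toMatrix j i = 0 := by
    intro j hj hji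
    have hjl : j ∈ l' := by
      by_contra hjl
      have h1 := hm0' j hjl
      rw [hmm', hmJ, Finsupp.filter_apply_pos _ _ (by simp [hj, hji])] at h1
      exact (hlpos j (hJ j hj)).ne' h1
    have h1 := hed j hjl
    have h2 : A.toMatrix j i ≤ 0 := A.offDiag j i hji
    rw [he0, Pi.zero_apply] at h1
    omega
  intro a ha b hb hab
  by_cases hai : a = i
  · subst hai
    exact (A.zero_iff _ _).2 (hzero b hb hab.symm)
  by_cases hbi : b = i
  · subst hbi
    exact hzero a ha hab
  exact ih a (by simp [ha, hai]) b (by simp [hb, hbi]) hab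

open Classical in
-- These are the coefficients of the signed independence polynomial of the Dynkin graph.
theorem coeff_label_weylNumerator (hρ : ∀ i, ρ (R.coroot i) = 1) (hp : p ∈ R.pairs)
    {J : Finset (Fin n)} (hJ : ∀ i ∈ J, i ∈ p.2) :
    coeff ((R.label p).filter (· ∈ J)) (R.weylNumerator ρ p) =
      if ∀ i ∈ J, ∀ j ∈ J, i ≠ j → A.toMatrix i j = 0 then (-1) ^ J.card else 0 := by
  split_ifs with h
  · exact coeff_label_weylNumerator_of_indep hρ hp hJ h
  · by_contra hne
    obtain ⟨l, hl, hlm, -⟩ := exists_word_of_coeff_ne_zero hρ hp hne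
    exact h (indep_of_coeff_label_ne_zero hρ hp (R.wordProd_mem hl) hJ hlm)

end GCM.Realization

/-! ### Signed independence polynomials and positivity of their logarithms. -/

namespace MvPowerSeries

/-- All coefficients are nonnegative. -/
def IsNonneg {σ : Type*} (f : MvPowerSeries σ ℚ) : Prop := ∀ m, 0 ≤ coeff m f

section Nonneg

variable {σ : Type*} {f g : MvPowerSeries σ ℚ}

theorem IsNonneg.mul (hf : IsNonneg f) (hg : IsNonneg g) : IsNonneg (f * g) := by
  classical
  intro m
  rw [coeff_mul]
  exact Finset.sum_nonneg fun x _ => mul_nonneg (hf _) (hg _)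

theorem isNonneg_X (i : σ) : IsNonneg (X i : MvPowerSeries σ ℚ) := by
  classical
  intro m
  rw [coeff_X]
  split_ifs <;> norm_num

theorem isNonneg_one : IsNonneg (1 : MvPowerSeries σ ℚ) := by
  classical
  intro m
  rw [coeff_one]
  split_ifs <;> norm_num

/-- The geometric series, in the recursive form $f=1+gf$. -/
theorem isNonneg_of_mul_one_sub_eq_one (hg : IsNonneg g) (h0 : constantCoeff g = 0)
    (h : f * (1 - g) = 1) : IsNonneg f := by
  classical
  have h' : f = 1 + g * f := by linear_combination h
  intro m
  induction m using WellFoundedLT.induction with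
  | _ m ih =>
  rw [h', map_add, coeff_mul]
  refine add_nonneg (isNonneg_one m) (Finset.sum_nonneg fun x hx => ?_)
  rw [Finset.HasAntidiagonal.mem_antidiagonal] at hx
  by_cases hx1 : x.1 = 0
  · rw [hx1, coeff_zero_eq_constantCoeff_apply, h0, zero_mul]
  · refine mul_nonneg (hg _) (ih _ ?_)
    rw [← hx]
    exact lt_add_of_pos_left _ (pos_iff_ne_zero.2 hx1)

end Nonneg

section IndepSeries

variable {σ : Type*} [DecidableEq σ] (Γ : SimpleGraph σ)

open Classical in
/-- The signed independence polynomial of the subgraph of `Γ` induced by `S`. -/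
noncomputable def indepSeries (S : Finset σ) : MvPowerSeries σ ℚ :=
  ∑ J ∈ S.powerset, if Γ.IsIndepSet (J : Set σ) then ∏ j ∈ J, -X j else 0

open Classical in
-- Independent sets either avoid $i$, or consist of $i$ and an independent set avoiding $i$ and its
-- neighbours.
theorem indepSeries_eq_sub {S : Finset σ} {i : σ} (hi : i ∈ S) :
    indepSeries Γ S = indepSeries Γ (S.erase i) -
      X i * indepSeries Γ ((S.erase i).filter fun j => ¬Γ.Adj i j) := by
  conv_lhs => rw [indepSeries, ← Finset.insert_erase hi,
    Finset.sum_powerset_insert (Finset.notMem_erase i S)]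
  rw [sub_eq_add_neg, ← neg_mul, indepSeries, indepSeries, Finset.mul_sum]
  congr 1
  symm
  refine Finset.sum_subset_zero_on_sdiff (Finset.powerset_mono.2 (Finset.filter_subset _ _)) ?_ ?_
  · intro J hJ
    rw [Finset.mem_sdiff, Finset.mem_powerset, Finset.mem_powerset] at hJ
    obtain ⟨j, hj, hj'⟩ := Finset.not_subset.1 hJ.2
    have hadj : Γ.Adj i j := by
      by_contra h
      exact hj' (Finset.mem_filter.2 ⟨hJ.1 hj, h⟩)
    refine if_neg fun hind => ?_
    exact hind (by simp) (by simp [hj]) hadj.ne hadj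
  · intro J hJ
    rw [Finset.mem_powerset] at hJ
    have hiJ : i ∉ J := fun h => by simpa using hJ h
    have hiff : Γ.IsIndepSet ((insert i J : Finset σ) : Set σ) ↔ Γ.IsIndepSet (J : Set σ) := by
      rw [Finset.coe_insert, SimpleGraph.isIndepSet_iff, SimpleGraph.isIndepSet_iff,
        Set.pairwise_insert]
      refine ⟨fun h => h.1, fun h => ⟨h, fun j hj _ => ?_⟩⟩
      have := (Finset.mem_filter.1 (hJ hj)).2
      exact ⟨this, fun h => this h.symm⟩
    simp only [hiff, Finset.prod_insert hiJ, mul_ite, mul_zero]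

theorem constantCoeff_indepSeries (S : Finset σ) : constantCoeff (indepSeries Γ S) = 1 := by
  classical
  rw [indepSeries, map_sum, Finset.sum_eq_single ∅]
  · simp
  · intro J _ hJ
    obtain ⟨j, hj⟩ := Finset.nonempty_iff_ne_empty.2 hJ
    split_ifs
    · rw [map_prod]
      exact Finset.prod_eq_zero hj (by simp)
    · simp
  · simp

theorem pderiv_indepSeries_of_notMem {S : Finset σ} {i : σ} (hi : i ∉ S) :
    pderiv ℚ i (indepSeries Γ S) = 0 := by
  classical
  have hprod : ∀ J : Finset σ, i ∉ J →
      pderiv ℚ i (∏ j ∈ J, -X j : MvPowerSeries σ ℚ) = 0 := by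
    intro J
    induction J using Finset.induction_on with
    | empty => simp
    | insert j J hj ih =>
      intro h
      rw [Finset.mem_insert, not_or] at h
      rw [Finset.prod_insert hj, Derivation.leibniz, ih h.2, map_neg,
        pderiv_X_of_ne (Ne.symm h.1)]
      simp
  rw [indepSeries, map_sum]
  refine Finset.sum_eq_zero fun J hJ => ?_
  split_ifs
  · exact hprod J fun h => hi (Finset.mem_powerset.1 hJ h)
  · simp

open Classical in
theorem pderiv_indepSeries {S : Finset σ} {i : σ} (hi : i ∈ S) :
    pderiv ℚ i (indepSeries Γ S) =
      -indepSeries Γ ((S.erase i).filter fun j => ¬Γ.Adj i j) := by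
  rw [indepSeries_eq_sub Γ hi, map_sub, Derivation.leibniz,
    pderiv_indepSeries_of_notMem Γ (by simp), pderiv_indepSeries_of_notMem Γ (by simp),
    pderiv_X_self]
  simp

theorem indepSeries_mul_inv (S : Finset σ) : indepSeries Γ S * (indepSeries Γ S)⁻¹ = 1 :=
  MvPowerSeries.mul_inv_cancel _ (by rw [constantCoeff_indepSeries]; norm_num)

/-- For `T ⊆ S`, the quotient of the signed independence polynomials of `T` and `S` has nonnegative
coefficients. -/
theorem isNonneg_indepSeries_div {S T : Finset σ} (hTS : T ⊆ S) :
    IsNonneg (indepSeries Γ T * (indepSeries Γ S)⁻¹) := by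
  classical
  induction hN : S.card generalizing S T with
  | zero =>
    rw [Finset.card_eq_zero] at hN
    subst hN
    rw [Finset.subset_empty.1 hTS, indepSeries_mul_inv]
    exact isNonneg_one
  | succ N ih =>
    rcases eq_or_ne T S with rfl | hne
    · rw [indepSeries_mul_inv]
      exact isNonneg_one
    obtain ⟨v, hvS, hvT⟩ := Finset.exists_of_ssubset (lt_of_le_of_ne hTS hne)
    have hcard : (S.erase v).card = N := by rw [Finset.card_erase_of_mem hvS, hN]; rfl
    have hTv : T ⊆ S.erase v := fun t ht => Finset.mem_erase.2 ⟨fun e => hvT (e ▸ ht), hTS ht⟩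
    set f := indepSeries Γ (S.erase v) with hf
    set F := indepSeries Γ S with hF
    -- Delete one vertex $v$ at a time. By the vertex recursion $f/F=1/(1-g)$, where $g$ is $x_v$
    -- times a quotient that is nonnegative by induction.
    have hsplit : indepSeries Γ T * F⁻¹ = indepSeries Γ T * f⁻¹ * (f * F⁻¹) := by
      have : f * f⁻¹ = 1 := indepSeries_mul_inv Γ _
      linear_combination (-indepSeries Γ T * F⁻¹) * this
    rw [hsplit]
    refine (ih hTv hcard).mul ?_
    refine isNonneg_of_mul_one_sub_eq_one
      (g := X v * (indepSeries Γ ((S.erase v).filter fun j => ¬Γ.Adj v j) * f⁻¹))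
      ((isNonneg_X v).mul (ih (Finset.filter_subset _ _) hcard)) (by simp) ?_
    have h1 : f * f⁻¹ = 1 := indepSeries_mul_inv Γ _
    have h2 : F * F⁻¹ = 1 := indepSeries_mul_inv Γ _
    have h3 := indepSeries_eq_sub Γ hvS
    rw [← hF, ← hf] at h3
    linear_combination (-X v * (indepSeries Γ ((S.erase v).filter fun j => ¬Γ.Adj v j)) * F⁻¹) * h1
      + h2 - F⁻¹ * h3

theorem pderiv_negLog_indepSeries [Fintype σ] [DecidableRel Γ.Adj] (i : σ) :
    pderiv ℚ i (negLog (indepSeries Γ Finset.univ)) =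
      indepSeries Γ ((Finset.univ.erase i).filter fun j => ¬Γ.Adj i j) *
        (indepSeries Γ Finset.univ)⁻¹ := by
  have h1 := mul_pderiv_negLog (constantCoeff_indepSeries Γ Finset.univ) i
  rw [pderiv_indepSeries Γ (Finset.mem_univ i), neg_neg] at h1
  have h2 := indepSeries_mul_inv Γ Finset.univ
  have h3 : indepSeries Γ ((Finset.univ.erase i).filter fun j => ¬Γ.Adj i j) =
      indepSeries Γ Finset.univ * pderiv ℚ i (negLog (indepSeries Γ Finset.univ)) := by
    rw [h1]
    congr!
  rw [h3]
  linear_combination (-pderiv ℚ i (negLog (indepSeries Γ Finset.univ))) * h2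

/-- The squarefree monomial of a set of variables. -/
noncomputable def indicatorExp (L : Finset σ) : σ →₀ ℕ := Finsupp.indicator L fun _ _ => 1

theorem indicatorExp_apply (L : Finset σ) (i : σ) :
    indicatorExp L i = if i ∈ L then 1 else 0 := by
  simp [indicatorExp, Finsupp.indicator_apply]

theorem indicatorExp_injective : Function.Injective (indicatorExp : Finset σ → σ →₀ ℕ) := by
  intro L M h
  ext i
  have := DFunLike.congr_fun h i
  simp only [indicatorExp_apply] at this
  split_ifs at this <;> simp_all

theorem indicatorExp_erase_add_single {L : Finset σ} {i : σ} (hi : i ∈ L) :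
    indicatorExp (L.erase i) + Finsupp.single i 1 = indicatorExp L := by
  ext j
  rw [Finsupp.add_apply, indicatorExp_apply, indicatorExp_apply]
  by_cases hj : j = i
  · subst hj; simp [hi]
  · simp [hj]

theorem prod_neg_X_eq_monomial (J : Finset σ) :
    (∏ j ∈ J, -X j : MvPowerSeries σ ℚ) = monomial (indicatorExp J) ((-1) ^ J.card) := by
  induction J using Finset.induction_on with
  | empty =>
    have : indicatorExp (∅ : Finset σ) = 0 := by ext; simp [indicatorExp_apply]
    simp [this]
  | insert j J hj ih =>
    rw [Finset.prod_insert hj, ih, ← indicatorExp_erase_add_single (Finset.mem_insert_self j J),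
      Finset.erase_insert hj, Finset.card_insert_of_notMem hj, X, neg_mul,
      monomial_mul_monomial, add_comm, ← map_neg, pow_succ']
    simp

open Classical in
theorem coeff_indicatorExp_indepSeries {S J : Finset σ} (hJ : J ⊆ S) :
    coeff (indicatorExp J) (indepSeries Γ S) =
      if Γ.IsIndepSet (J : Set σ) then (-1) ^ J.card else 0 := by
  rw [indepSeries, map_sum, Finset.sum_eq_single J]
  · rw [prod_neg_X_eq_monomial]
    split_ifs <;> simp
  · intro M _ hM
    split_ifs
    · rw [prod_neg_X_eq_monomial, coeff_monomial, if_neg fun h => hM (indicatorExp_injective h).symm]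
    · simp
  · intro h
    exact absurd (Finset.mem_powerset.2 hJ) h

theorem exists_preconnected_induce_erase {L : Finset σ} (hL : 1 < L.card)
    (hconn : (Γ.induce (L : Set σ)).Preconnected) :
    ∃ i ∈ L, (Γ.induce (L.erase i : Finset σ)).Preconnected ∧ ∃ j ∈ L.erase i, Γ.Adj i j := by
  have : Nontrivial (L : Set σ) := by
    rw [Set.nontrivial_coe_sort]
    exact Finset.one_lt_card_iff_nontrivial.1 hL
  have hc : (Γ.induce (L : Set σ)).Connected := ⟨hconn⟩
  obtain ⟨i, hi⟩ := hc.exists_preconnected_induce_compl_singleton_of_finite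
  obtain ⟨j, hj⟩ := hconn.exists_adj_of_nontrivial i
  refine ⟨i, i.2, ?_, j, ?_, hj⟩
  · refine hi.map (⟨fun x => ⟨x.1.1, ?_⟩, fun {x y} h => h⟩ :
      (Γ.induce (L : Set σ)).induce {i}ᶜ →g Γ.induce (L.erase i : Finset σ)) ?_
    · rw [Finset.mem_coe, Finset.mem_erase]
      exact ⟨fun h => x.2 (Subtype.ext h), x.1.2⟩
    · rintro ⟨x, hx⟩
      rw [Finset.mem_coe, Finset.mem_erase] at hx
      exact ⟨⟨⟨x, hx.2⟩, fun h => hx.1 (congrArg Subtype.val h)⟩, rfl⟩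
  · rw [Finset.mem_erase]
    exact ⟨fun h => hj.ne (Subtype.ext h.symm), j.2⟩

/-- The squarefree coefficient of a connected set in the negative logarithm of the signed
independence polynomial is positive. -/
theorem coeff_negLog_indepSeries_pos [Fintype σ] {L : Finset σ} (hne : L.Nonempty)
    (hconn : (Γ.induce (L : Set σ)).Preconnected) :
    0 < coeff (indicatorExp L) (negLog (indepSeries Γ Finset.univ)) := by
  classical
  set P := indepSeries Γ Finset.univ with hP
  have hcoef : ∀ i ∈ L, coeff (indicatorExp L) (negLog P) =
      coeff (indicatorExp (L.erase i)) (pderiv ℚ i (negLog P)) := by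
    intro i hi
    rw [coeff_pderiv, indicatorExp_erase_add_single hi, indicatorExp_apply]
    simp
  induction hN : L.card generalizing L with
  | zero => exact absurd (Finset.card_eq_zero.1 hN) hne.ne_empty
  | succ N ih =>
  rcases Nat.eq_zero_or_pos N with rfl | hNpos
  · obtain ⟨i, rfl⟩ := Finset.card_eq_one.1 hN
    have h0 : indicatorExp (({i} : Finset σ).erase i) = 0 := by ext; simp [indicatorExp_apply]
    rw [hcoef i (by simp), h0, coeff_zero_eq_constantCoeff_apply, pderiv_negLog_indepSeries,
      map_mul, constantCoeff_inv, constantCoeff_indepSeries, constantCoeff_indepSeries]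
    norm_num
  -- Remove a non-cut vertex $i$ with a neighbour $j$ in $L$. It suffices to bound $\partial_i(-\log
  -- P)$ below coefficientwise by $1+x_j\partial_j(-\log P)$, whose coefficient at $L\setminus\{i\}$
  -- is positive by induction.
  obtain ⟨i, hi, hconn', j, hj, hadj⟩ := exists_preconnected_induce_erase Γ (by omega) hconn
  have hcard : (L.erase i).card = N := by rw [Finset.card_erase_of_mem hi, hN]; rfl
  have ih' := ih (L := L.erase i) ⟨j, hj⟩ hconn' (by
    intro k hk
    rw [coeff_pderiv, indicatorExp_erase_add_single hk, indicatorExp_apply]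
    simp) hcard
  set T := (Finset.univ.erase i).filter fun j => ¬Γ.Adj i j with hT
  set Q := indepSeries Γ (Finset.univ.erase j) with hQ
  have hTj : T ⊆ Finset.univ.erase j := by
    intro t ht
    refine Finset.mem_erase.2 ⟨?_, Finset.mem_univ t⟩
    rintro rfl
    exact (Finset.mem_filter.1 ht).2 hadj
  have hQQ : Q * Q⁻¹ = 1 := indepSeries_mul_inv Γ _
  have hPP : P * P⁻¹ = 1 := indepSeries_mul_inv Γ _
  -- As $j$ is a neighbour of $i$, $T$ omits $j$. Hence $I_T/Q$ is nonnegative with constant term 1,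
  -- where $I_T$ is the series of $T$; and $Q/P=1+x_j\partial_j(-\log P)$.
  have hdiff : IsNonneg ((indepSeries Γ T * Q⁻¹ - 1) * (Q * P⁻¹)) := by
    refine IsNonneg.mul (fun m => ?_) (isNonneg_indepSeries_div Γ (Finset.subset_univ _))
    by_cases hm : m = 0
    · rw [hm, coeff_zero_eq_constantCoeff_apply, map_sub, map_mul, constantCoeff_inv,
        constantCoeff_indepSeries, constantCoeff_indepSeries]
      norm_num
    · rw [map_sub, coeff_one, if_neg hm, sub_zero]
      exact isNonneg_indepSeries_div Γ hTj m
  have heq : indepSeries Γ T * P⁻¹ =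
      (indepSeries Γ T * Q⁻¹ - 1) * (Q * P⁻¹) + (1 + X j * pderiv ℚ j (negLog P)) := by
    have h3 := indepSeries_eq_sub Γ (Finset.mem_univ j)
    rw [pderiv_negLog_indepSeries, ← hP]
    rw [← hP, ← hQ] at h3
    linear_combination (-indepSeries Γ T * P⁻¹) * hQQ - P⁻¹ * h3 + hPP
  have hne0 : indicatorExp (L.erase i) ≠ 0 := by
    intro h
    have := DFunLike.congr_fun h j
    rw [indicatorExp_apply, if_pos hj] at this
    simp at this
  rw [hcoef i hi, pderiv_negLog_indepSeries, ← hP, ← hT, heq, map_add, map_add,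
    coeff_X_mul_pderiv, coeff_one, if_neg hne0, zero_add, indicatorExp_apply, if_pos hj,
    Nat.cast_one, one_mul]
  exact add_pos_of_nonneg_of_pos (hdiff _) ih'

end IndepSeries

end MvPowerSeries

/-! ### Exponents and minimal coefficients of a negative logarithm. -/

namespace MvPowerSeries

variable {σ : Type*} {f f' : MvPowerSeries σ ℚ}

theorem coeff_zero_negLog (hf : constantCoeff f = 1) : coeff 0 (negLog f) = 0 := by
  rw [coeff_zero_eq_constantCoeff_apply, constantCoeff_negLog hf]

variable [DecidableEq σ]

/-- A condition on the exponents of `f` that is closed upwards passes to `negLog f`. -/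
theorem coeff_negLog_ne_zero (hf : constantCoeff f = 1) {Q : σ → ℕ → Prop}
    (hQ : ∀ i a b, Q i a → a ≤ b → Q i b) (h : ∀ m, coeff m f ≠ 0 → ∀ i, m i ≠ 0 → Q i (m i))
    (m : σ →₀ ℕ) (hm : coeff m (negLog f) ≠ 0) (i : σ) (hi : m i ≠ 0) : Q i (m i) := by
  induction m using WellFoundedLT.induction generalizing i with
  | _ m ih =>
  by_cases hu : coeff m f = 0
  -- The term with first component 0 isolates the coefficient at `m`. If it is nonzero, some other
  -- term has a smaller exponent whose `i`-entry is also nonzero, and `Q` lifts from there.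
  · have hsum := sum_antidiagonal_negLog hf i m
    rw [hu, mul_zero, neg_zero, ← Finset.add_sum_erase _ _
      (show (0, m) ∈ Finset.HasAntidiagonal.antidiagonal m by simp)] at hsum
    have h0 : coeff 0 f * (m i * coeff m (negLog f)) ≠ 0 := by
      rw [coeff_zero_eq_constantCoeff_apply, hf, one_mul]
      exact mul_ne_zero (by exact_mod_cast hi) hm
    have hne : ∑ x ∈ (Finset.HasAntidiagonal.antidiagonal m).erase (0, m),
        coeff x.1 f * (x.2 i * coeff x.2 (negLog f)) ≠ 0 := by
      intro h'
      rw [h', add_zero] at hsum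
      exact h0 hsum
    obtain ⟨x, hx, hx0⟩ := Finset.exists_ne_zero_of_sum_ne_zero hne
    rw [Finset.mem_erase, Finset.HasAntidiagonal.mem_antidiagonal] at hx
    have hx1 : x.1 ≠ 0 := by
      intro h1
      refine hx.1 (Prod.ext h1 ?_)
      rw [← hx.2, h1, zero_add]
    have hlt : x.2 < m := by
      rw [← hx.2]
      exact lt_add_of_pos_left _ (pos_iff_ne_zero.2 hx1)
    have hx2 := right_ne_zero_of_mul hx0
    exact hQ _ _ _ (ih _ hlt (right_ne_zero_of_mul hx2) i
      (by exact_mod_cast left_ne_zero_of_mul hx2)) (hlt.le i)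
  · exact h m hu i hi

/-- If the coefficients of `f` are multiplicative on sums of exponents with unrelated supports, then
`negLog f` vanishes at such sums. -/
theorem coeff_add_negLog_eq_zero (hf : constantCoeff f = 1) {r : σ → σ → Prop}
    (hr : ∀ i, ¬r i i)
    (hmul : ∀ a b : σ →₀ ℕ, (∀ i j, a i ≠ 0 → b j ≠ 0 → r i j) →
      coeff (a + b) f = coeff a f * coeff b f) {a b : σ →₀ ℕ} (ha : a ≠ 0) (hb : b ≠ 0)
    (hab : ∀ i j, a i ≠ 0 → b j ≠ 0 → r i j) : coeff (a + b) (negLog f) = 0 := by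
  induction hN : a + b using WellFoundedLT.induction generalizing a b with
  | _ N ih =>
  subst hN
  obtain ⟨i, hi⟩ := Finsupp.ne_iff.1 ha
  rw [Finsupp.zero_apply] at hi
  have hdis : ∀ j, a j ≠ 0 → b j = 0 := fun j hj => by
    by_contra hbj
    exact hr j (hab j j hj hbj)
  -- In the Euler identity at $a+b$, the pairs $(x+b,y)$ with $x+y=a$ give `coeff b f` times the
  -- identity at $a$, and $(0,a+b)$ gives the coefficient sought. Any other term either has $y_i=0$
  -- or has a smaller $y$ meeting both supports, and so vanishes by induction.
  set φ : (σ →₀ ℕ) × (σ →₀ ℕ) → ℚ := fun x => coeff x.1 f * (x.2 i * coeff x.2 (negLog f)) with hφ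
  have hsum : ∑ x ∈ Finset.HasAntidiagonal.antidiagonal (a + b), φ x =
      -((a + b) i * coeff (a + b) f) := sum_antidiagonal_negLog hf i (a + b)
  have hsuma : ∑ x ∈ Finset.HasAntidiagonal.antidiagonal a, φ x = -(a i * coeff a f) :=
    sum_antidiagonal_negLog hf i a
  have hinj : Set.InjOn (fun x : (σ →₀ ℕ) × (σ →₀ ℕ) => (x.1 + b, x.2))
      (Finset.HasAntidiagonal.antidiagonal a : Set ((σ →₀ ℕ) × (σ →₀ ℕ))) := by
    rintro ⟨x, y⟩ - ⟨x', y'⟩ - h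
    simp only [Prod.mk.injEq, add_left_inj] at h
    rw [h.1, h.2]
  have hnot : (0, a + b) ∉ (Finset.HasAntidiagonal.antidiagonal a).image
      fun x : (σ →₀ ℕ) × (σ →₀ ℕ) => (x.1 + b, x.2) := by
    simp only [Finset.mem_image, Prod.mk.injEq, not_exists, not_and]
    intro x _ h
    exact absurd (add_eq_zero.1 h).2 hb
  have hsub : insert (0, a + b) ((Finset.HasAntidiagonal.antidiagonal a).image
      fun x : (σ →₀ ℕ) × (σ →₀ ℕ) => (x.1 + b, x.2)) ⊆
      Finset.HasAntidiagonal.antidiagonal (a + b) := by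
    intro y hy
    rw [Finset.HasAntidiagonal.mem_antidiagonal]
    rcases Finset.mem_insert.1 hy with rfl | hy
    · simp
    · obtain ⟨x, hx, rfl⟩ := Finset.mem_image.1 hy
      rw [Finset.HasAntidiagonal.mem_antidiagonal] at hx
      rw [← hx]
      exact add_right_comm _ _ _
  have himg : ∀ x ∈ Finset.HasAntidiagonal.antidiagonal a, φ (x.1 + b, x.2) = coeff b f * φ x := by
    intro x hx
    rw [Finset.HasAntidiagonal.mem_antidiagonal] at hx
    simp only [hφ]
    rw [hmul x.1 b fun j k hj hk => hab j k (fun h => hj (by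
      have := DFunLike.congr_fun hx j
      rw [Finsupp.add_apply] at this
      omega)) hk]
    ring
  rw [← Finset.sum_subset hsub, Finset.sum_insert hnot, Finset.sum_image hinj,
    Finset.sum_congr rfl himg, ← Finset.mul_sum, hsuma, hmul a b hab] at hsum
  · simp only [hφ, coeff_zero_eq_constantCoeff_apply, hf, Finsupp.add_apply, hdis i hi,
      add_zero] at hsum
    have h0 : (a i : ℚ) * coeff (a + b) (negLog f) = 0 := by linear_combination hsum
    exact (mul_eq_zero.1 h0).resolve_left (by exact_mod_cast hi)
  · rintro ⟨x, y⟩ hxy hnotin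
    rw [Finset.HasAntidiagonal.mem_antidiagonal] at hxy
    simp only at hxy
    rw [Finset.mem_insert, not_or] at hnotin
    simp only [hφ]
    by_cases hyi : y i = 0
    · simp [hyi]
    have hxyj : ∀ j, x j + y j = a j + b j := fun j => by
      have := DFunLike.congr_fun hxy j
      simpa using this
    set ya := y.filter (a · ≠ 0) with hya
    set yb := y.filter (¬a · ≠ 0) with hyb
    have hy : ya + yb = y := Finsupp.filter_add_filter_not y _
    have hya_apply : ∀ j, ya j = if a j ≠ 0 then y j else 0 := fun j => Finsupp.filter_apply _ _ _
    have hyb_apply : ∀ j, yb j = if ¬a j ≠ 0 then y j else 0 := fun j => Finsupp.filter_apply _ _ _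
    by_cases hyb0 : yb = 0
    · exfalso
      refine hnotin.2 (Finset.mem_image.2 ⟨(a - y, y), ?_, ?_⟩)
      · rw [Finset.HasAntidiagonal.mem_antidiagonal]
        refine tsub_add_cancel_of_le fun j => ?_
        have h1 := hxyj j
        have h2 := hyb_apply j
        rw [hyb0, Finsupp.zero_apply] at h2
        by_cases haj : a j = 0
        · rw [if_pos (by simpa using haj)] at h2
          omega
        · have := hdis j haj
          omega
      · refine Prod.ext ?_ rfl
        ext j
        have h1 := hxyj j
        have h2 := hyb_apply j
        rw [hyb0, Finsupp.zero_apply] at h2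
        simp only [Finsupp.add_apply, Finsupp.tsub_apply]
        by_cases haj : a j = 0
        · rw [if_pos (by simpa using haj)] at h2
          omega
        · have := hdis j haj
          omega
    · have hya0 : ya ≠ 0 := by
        intro h
        have := hya_apply i
        rw [h, Finsupp.zero_apply, if_pos hi] at this
        exact hyi this.symm
      have hlt : ya + yb < a + b := by
        rw [hy]
        refine lt_of_le_of_ne (by rw [← hxy]; exact le_add_self) fun h => hnotin.1 ?_
        subst h
        rw [add_eq_right.1 hxy]
      have := ih _ hlt hya0 hyb0 (fun j k hj hk => by
        rw [hya_apply] at hj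
        rw [hyb_apply] at hk
        have haj : a j ≠ 0 := by
          intro h
          simp [h] at hj
        have hak : a k = 0 := by
          by_contra h
          simp [h] at hk
        refine hab j k haj fun hbk => ?_
        have h1 := hxyj k
        rw [if_pos (by simpa using hak)] at hk
        omega) rfl
      rw [hy] at this
      rw [this]
      simp

/-- If the coefficients of `f` are multiplicative on pairs of exponents supported on sets of
variables without edges between them, then the support of every exponent of `negLog f` is
connected. -/
theorem preconnected_of_coeff_negLog_ne_zero (hf : constantCoeff f = 1) (Γ : SimpleGraph σ)
    (hmul : ∀ a b : σ →₀ ℕ, (∀ i j, a i ≠ 0 → b j ≠ 0 → i ≠ j ∧ ¬Γ.Adj i j) →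
      coeff (a + b) f = coeff a f * coeff b f) {m : σ →₀ ℕ} (hm : coeff m (negLog f) ≠ 0) :
    (Γ.induce (m.support : Set σ)).Preconnected := by
  classical
  by_contra hcon
  simp only [SimpleGraph.Preconnected, not_forall] at hcon
  obtain ⟨u, v, huv⟩ := hcon
  -- The component of `u` in the support; cutting the exponent along it leaves no edges between the
  -- two parts.
  set C : σ → Prop := fun x => ∃ hx : x ∈ (m.support : Set σ),
    (Γ.induce (m.support : Set σ)).Reachable u ⟨x, hx⟩ with hC
  refine hm ?_
  rw [← Finsupp.filter_add_filter_not m C]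
  refine coeff_add_negLog_eq_zero hf (r := fun i j => i ≠ j ∧ ¬Γ.Adj i j) (fun i h => h.1 rfl) hmul
    ?_ ?_ ?_
  · intro h
    have := DFunLike.congr_fun h u.1
    rw [Finsupp.filter_apply_pos C _ ⟨u.2, SimpleGraph.Reachable.refl u⟩] at this
    exact (Finsupp.mem_support_iff.1 u.2) this
  · intro h
    have := DFunLike.congr_fun h v.1
    rw [Finsupp.filter_apply_pos (fun x => ¬C x) _ (fun ⟨_, h⟩ => huv h)] at this
    exact (Finsupp.mem_support_iff.1 v.2) this
  · intro i j hi hj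
    have hiC : C i := by
      by_contra h
      exact hi (Finsupp.filter_apply_neg C _ h)
    have hjC : ¬C j := by
      intro h
      exact hj (Finsupp.filter_apply_neg (fun x => ¬C x) _ (not_not.2 h))
    refine ⟨fun h => hjC (h ▸ hiC), fun hadj => hjC ?_⟩
    obtain ⟨hx, hr⟩ := hiC
    have hjm : j ∈ (m.support : Set σ) := by
      rw [Finset.mem_coe, Finsupp.mem_support_iff]
      rwa [Finsupp.filter_apply_pos (fun x => ¬C x) _ hjC] at hj
    refine ⟨hjm, hr.trans (SimpleGraph.Adj.reachable ?_)⟩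
    exact hadj

/-- Neither summand may have a nonzero entry below $d_i$, so each $d_i$ goes whole to one side. -/
theorem sum_antidiagonal_filter_eq_sum_powerset {d : σ →₀ ℕ} {L : Finset σ}
    (hL : ∀ i ∈ L, 0 < d i) {φ : (σ →₀ ℕ) × (σ →₀ ℕ) → ℚ}
    (hφ : ∀ x, φ x ≠ 0 → ∀ i, (x.1 i ≠ 0 → d i ≤ x.1 i) ∧ (x.2 i ≠ 0 → d i ≤ x.2 i)) :
    ∑ x ∈ Finset.HasAntidiagonal.antidiagonal (d.filter (· ∈ L)), φ x =
      ∑ M ∈ L.powerset, φ (d.filter (· ∈ L \ M), d.filter (· ∈ M)) := by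
  have hinj : Set.InjOn (fun M : Finset σ => (d.filter (· ∈ L \ M), d.filter (· ∈ M)))
      (L.powerset : Set (Finset σ)) := by
    intro M hM M' hM' h
    have h2 := (Prod.ext_iff.1 h).2
    simp only at h2
    rw [Finset.mem_coe, Finset.mem_powerset] at hM hM'
    ext i
    have := DFunLike.congr_fun h2 i
    rw [Finsupp.filter_apply, Finsupp.filter_apply] at this
    constructor
    · intro hi
      by_contra hi'
      rw [if_pos hi, if_neg hi'] at this
      exact (hL i (hM hi)).ne' this
    · intro hi
      by_contra hi'
      rw [if_pos hi, if_neg hi'] at this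
      exact (hL i (hM' hi)).ne this
  rw [← Finset.sum_image (f := φ) hinj]
  symm
  refine Finset.sum_subset ?_ ?_
  · intro x hx
    obtain ⟨M, hM, rfl⟩ := Finset.mem_image.1 hx
    rw [Finset.mem_powerset] at hM
    rw [Finset.HasAntidiagonal.mem_antidiagonal]
    ext i
    simp only [Finsupp.add_apply, Finsupp.filter_apply, Finset.mem_sdiff]
    by_cases hiM : i ∈ M
    · simp [hiM, hM hiM]
    · simp [hiM]
  · rintro ⟨x, y⟩ hxy hnot
    by_contra hne
    refine hnot (Finset.mem_image.2 ⟨L.filter (y · ≠ 0), ?_, ?_⟩)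
    · exact Finset.mem_powerset.2 (Finset.filter_subset _ _)
    rw [Finset.HasAntidiagonal.mem_antidiagonal] at hxy
    have key : ∀ i, x i + y i = if i ∈ L then d i else 0 := by
      intro i
      rw [← Finsupp.filter_apply, ← hxy]
      rfl
    refine Prod.ext ?_ ?_
    all_goals
      ext i
      have h1 := key i
      have h2 := hφ _ hne i
      simp only at h2
      simp only [Finsupp.filter_apply, Finset.mem_sdiff, Finset.mem_filter]
      by_cases hi : i ∈ L
      · have := hL i hi
        rw [if_pos hi] at h1
        by_cases hy : y i = 0
        · simp [hi, hy] <;> omega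
        · have := h2.2 hy
          simp [hi, hy]; omega
      · rw [if_neg hi] at h1
        simp [hi]; omega

/-- The Euler identity at $d|_L$ divided by $d_i$. The values of $d$ no longer appear as factors,
which allows a comparison between different `d`. -/
theorem sum_powerset_negLog (hf : constantCoeff f = 1) {d : σ →₀ ℕ} {L : Finset σ}
    (hL : ∀ i ∈ L, 0 < d i) (hd : ∀ m, coeff m f ≠ 0 → ∀ i, m i ≠ 0 → d i ≤ m i)
    {i : σ} (hi : i ∈ L) :
    ∑ M ∈ L.powerset, coeff (d.filter (· ∈ L \ M)) f *
      (if i ∈ M then coeff (d.filter (· ∈ M)) (negLog f) else 0) =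
        -coeff (d.filter (· ∈ L)) f := by
  have h := sum_antidiagonal_negLog hf i (d.filter (· ∈ L))
  have hlog := coeff_negLog_ne_zero hf (Q := fun i a => d i ≤ a) (fun _ _ _ => le_trans) hd
  rw [sum_antidiagonal_filter_eq_sum_powerset hL (φ := fun x =>
    coeff x.1 f * (x.2 i * coeff x.2 (negLog f)))] at h
  · have hdi : (d i : ℚ) ≠ 0 := by exact_mod_cast (hL i hi).ne'
    refine mul_left_cancel₀ hdi ?_
    rw [Finsupp.filter_apply_pos (· ∈ L) _ hi] at h
    rw [mul_neg, ← h, Finset.mul_sum]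
    refine Finset.sum_congr rfl fun M _ => ?_
    simp only [Finsupp.filter_apply]
    split_ifs
    · ring
    · simp
  · intro x hx j
    exact ⟨hd _ (left_ne_zero_of_mul hx) j,
      hlog _ (right_ne_zero_of_mul (right_ne_zero_of_mul hx)) j⟩

/-- The coefficients of `negLog f` at minimal exponents are determined by the coefficients of `f` at
minimal exponents. -/
theorem coeff_filter_negLog_eq (hf : constantCoeff f = 1) (hf' : constantCoeff f' = 1)
    {d d' : σ →₀ ℕ} {L : Finset σ} (hL : ∀ i ∈ L, 0 < d i) (hL' : ∀ i ∈ L, 0 < d' i)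
    (hd : ∀ m, coeff m f ≠ 0 → ∀ i, m i ≠ 0 → d i ≤ m i)
    (hd' : ∀ m, coeff m f' ≠ 0 → ∀ i, m i ≠ 0 → d' i ≤ m i)
    (h : ∀ M ⊆ L, coeff (d.filter (· ∈ M)) f = coeff (d'.filter (· ∈ M)) f') :
    coeff (d.filter (· ∈ L)) (negLog f) = coeff (d'.filter (· ∈ L)) (negLog f') := by
  induction L using Finset.strongInduction with
  | H L ih =>
  have hempty : ∀ e : σ →₀ ℕ, e.filter (· ∈ (∅ : Finset σ)) = 0 := fun e => by ext; simp
  rcases L.eq_empty_or_nonempty with rfl | ⟨i, hi⟩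
  · rw [hempty, hempty, coeff_zero_negLog hf, coeff_zero_negLog hf']
  have h1 := sum_powerset_negLog hf hL hd hi
  have h2 := sum_powerset_negLog hf' hL' hd' hi
  rw [← Finset.add_sum_erase _ _ (Finset.mem_powerset_self L), if_pos hi, Finset.sdiff_self, hempty,
    coeff_zero_eq_constantCoeff_apply] at h1 h2
  rw [hf, one_mul] at h1
  rw [hf', one_mul, ← h L subset_rfl, ← h1] at h2
  have hrest : ∑ M ∈ L.powerset.erase L, coeff (d.filter (· ∈ L \ M)) f *
      (if i ∈ M then coeff (d.filter (· ∈ M)) (negLog f) else 0) =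
      ∑ M ∈ L.powerset.erase L, coeff (d'.filter (· ∈ L \ M)) f' *
      (if i ∈ M then coeff (d'.filter (· ∈ M)) (negLog f') else 0) := by
    refine Finset.sum_congr rfl fun M hM => ?_
    rw [Finset.mem_erase, Finset.mem_powerset] at hM
    rw [h _ Finset.sdiff_subset, ih M (lt_of_le_of_ne hM.2 hM.1) (fun j hj => hL j (hM.2 hj))
      (fun j hj => hL' j (hM.2 hj)) fun N hN => h N (hN.trans hM.2)]
  rw [hrest] at h2
  exact (add_right_cancel h2).symm

end MvPowerSeries

/-! ### Lifts, specialization and triangularity. -/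

namespace GCM.Realization

open MvPowerSeries

variable {n : ℕ} {A : GCM n} {𝔥 : Type*} [AddCommGroup 𝔥] [Module ℂ 𝔥] {R : A.Realization 𝔥}
  {ρ : Dual ℂ 𝔥} {p q : Dual ℂ 𝔥 × Set (Fin n)}

theorem negLogNumerator_eq : R.negLogNumerator ρ p = negLog (R.weylNumerator ρ p) := rfl

theorem coeff_negLogNumerator_ne_zero (hρ : ∀ i, ρ (R.coroot i) = 1) (hp : p ∈ R.pairs)
    {m : Fin n →₀ ℕ} (hm : coeff m (R.negLogNumerator ρ p) ≠ 0) {i : Fin n} (hi : m i ≠ 0) :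
    i ∈ p.2 ∧ R.label p i ≤ m i :=
  coeff_negLog_ne_zero (constantCoeff_weylNumerator hρ hp)
    (Q := fun i a => i ∈ p.2 ∧ R.label p i ≤ a) (fun _ _ _ h hab => ⟨h.1, h.2.trans hab⟩)
    (fun _ h _ => coeff_weylNumerator_ne_zero hρ hp h) m hm i hi

theorem isConnected_support_of_coeff_negLogNumerator_ne_zero (hρ : ∀ i, ρ (R.coroot i) = 1)
    (hp : p ∈ R.pairs) {m : Fin n →₀ ℕ} (hm : coeff m (R.negLogNumerator ρ p) ≠ 0) :
    A.IsConnected (m.support : Set (Fin n)) := by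
  refine preconnected_of_coeff_negLog_ne_zero (constantCoeff_weylNumerator hρ hp) A.dynkinGraph
    (fun a b hab => coeff_add_weylNumerator hρ hp fun i j hi hj => ?_) hm
  by_contra h
  exact (hab i j hi hj).2 ⟨(hab i j hi hj).1, h⟩

/-- At restricted labels the Weyl numerator agrees with the independence polynomial at squarefree
exponents, whose label is constantly 1. The coefficients of the logarithms agree as well, and the
squarefree one is positive. -/
theorem coeff_label_negLogNumerator_pos (hρ : ∀ i, ρ (R.coroot i) = 1) (hp : p ∈ R.pairs)
    {L : Finset (Fin n)} (hL : ∀ i ∈ L, i ∈ p.2) (hne : L.Nonempty)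
    (hconn : A.IsConnected (L : Set (Fin n))) :
    0 < coeff ((R.label p).filter (· ∈ L)) (R.negLogNumerator ρ p) := by
  classical
  have hfilter : ∀ M : Finset (Fin n),
      (indicatorExp (Finset.univ : Finset (Fin n))).filter (· ∈ M) = indicatorExp M := by
    intro M
    ext i
    simp [Finsupp.filter_apply, indicatorExp_apply]
  rw [negLogNumerator_eq, coeff_filter_negLog_eq (constantCoeff_weylNumerator hρ hp)
    (constantCoeff_indepSeries A.dynkinGraph Finset.univ) (d' := indicatorExp Finset.univ)
    (fun i hi => label_pos_iff.2 (hL i hi)) (fun i _ => by simp [indicatorExp_apply])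
    (fun m hm i hi => (coeff_weylNumerator_ne_zero hρ hp hm hi).2)
    (fun m _ i hi => by simpa [indicatorExp_apply] using Nat.one_le_iff_ne_zero.2 hi), hfilter]
  · exact coeff_negLog_indepSeries_pos A.dynkinGraph hne hconn
  · intro M hM
    rw [hfilter, coeff_label_weylNumerator hρ hp fun i hi => hL i (hM hi),
      coeff_indicatorExp_indepSeries _ (Finset.subset_univ M)]
    refine if_congr ?_ rfl rfl
    rw [SimpleGraph.isIndepSet_iff]
    constructor
    · intro h i hi j hj hij hadj
      exact hadj.2 (h i hi j hj hij)
    · intro h i hi j hj hij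
      by_contra h0
      exact h hi hj hij ⟨hij, h0⟩

variable {rel : Setoid (Fin n)}

theorem label_eq_of_rel (hp : p ∈ R.symmetricPairs rel) {i j : Fin n} (hij : rel i j) :
    R.label p i = R.label p j := by
  obtain ⟨⟨hpp, -⟩, hsym, hun, -⟩ := hp
  by_cases hi : i ∈ p.2
  · have h : (R.label p i : ℂ) = R.label p j := by
      rw [cast_label hpp hi, cast_label hpp (hun i j hij hi), hsym i j hij]
    exact_mod_cast h
  · rw [label_eq_zero_iff.2 hi, label_eq_zero_iff.2 fun hj => hi (hun j i (rel.symm' hij) hj)]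

open Classical in
theorem mapDomain_mk_apply (m : Fin n →₀ ℕ) (i : Fin n) :
    m.mapDomain (Quotient.mk rel) (Quotient.mk rel i) =
      ∑ j ∈ m.support with rel i j, m j := by
  rw [Finsupp.mapDomain_apply_eq_sum]
  refine Finset.sum_congr (Finset.filter_congr fun j _ => ?_) fun _ _ => rfl
  rw [Quotient.eq]
  exact ⟨fun h => rel.symm' h, fun h => rel.symm' h⟩

open Classical in
theorem ncard_inter_class (L : Finset (Fin n)) (i : Fin n) :
    ((L : Set (Fin n)) ∩ {j | rel i j}).ncard = (L.filter (rel i ·)).card := by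
  rw [← Set.ncard_coe_finset, Finset.coe_filter]
  rfl

/-- The exponent obtained by restricting the labels of `p` to `L` and specializing. -/
noncomputable def liftExp (R : A.Realization 𝔥) (rel : Setoid (Fin n))
    (p : Dual ℂ 𝔥 × Set (Fin n)) (L : Finset (Fin n)) : Quotient rel →₀ ℕ :=
  ((R.label p).filter (· ∈ L)).mapDomain (Quotient.mk rel)

theorem support_filter_label {L : Finset (Fin n)} (hL : (L : Set (Fin n)) ⊆ p.2) :
    ((R.label p).filter (· ∈ L)).support = L := by
  ext i
  rw [Finsupp.mem_support_iff, Finsupp.filter_apply]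
  constructor
  · intro h
    by_contra hi
    exact h (if_neg hi)
  · intro hi
    rw [if_pos hi]
    exact (label_pos_iff.2 (hL hi)).ne'

open Classical in
theorem liftExp_apply (hp : p ∈ R.symmetricPairs rel) {L : Finset (Fin n)}
    (hL : (L : Set (Fin n)) ⊆ p.2) (i : Fin n) :
    liftExp R rel p L (Quotient.mk rel i) = (L.filter (rel i ·)).card * R.label p i := by
  rw [liftExp, mapDomain_mk_apply, support_filter_label hL, ← smul_eq_mul]
  refine Finset.sum_eq_card_nsmul fun j hj => ?_
  rw [Finset.mem_filter] at hj
  rw [Finsupp.filter_apply_pos (· ∈ L) _ hj.1, label_eq_of_rel hp hj.2]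

section Comparison

variable {L : Finset (Fin n)} {m : Fin n →₀ ℕ}

open Classical in
theorem card_class_pos (hL : A.IsLeanLift rel p.2 L) {i : Fin n} (hi : i ∈ p.2) :
    0 < (L.filter (rel i ·)).card := by
  obtain ⟨j, hj, hij⟩ := hL.1.2.2 i hi
  exact Finset.card_pos.2 ⟨j, Finset.mem_filter.2 ⟨hj, hij⟩⟩

/-- The test exponent is positive on every class in `p.2`, so the support of `m` meets all of them;
and `q.2` contains that support and is a union of classes. -/
theorem subset_of_coeff_ne_zero (hρ : ∀ i, ρ (R.coroot i) = 1) (hp : p ∈ R.symmetricPairs rel)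
    (hq : q ∈ R.symmetricPairs rel) (hL : A.IsLeanLift rel p.2 L)
    (hm : coeff m (R.negLogNumerator ρ q) ≠ 0)
    (hmap : m.mapDomain (Quotient.mk rel) = liftExp R rel p L) :
    p.2 ⊆ q.2 ∧ ∀ i ∈ p.2, ∃ j ∈ m.support, rel i j := by
  classical
  have hex : ∀ i ∈ p.2, ∃ j ∈ m.support, rel i j := by
    intro i hi
    have h := DFunLike.congr_fun hmap (Quotient.mk rel i)
    rw [mapDomain_mk_apply, liftExp_apply hp hL.1.1] at h
    have hpos : 0 < (L.filter (rel i ·)).card * R.label p i :=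
      Nat.mul_pos (card_class_pos hL hi) (label_pos_iff.2 hi)
    obtain ⟨j, hj, -⟩ := Finset.exists_ne_zero_of_sum_ne_zero (h.trans_ne hpos.ne')
    exact ⟨j, (Finset.mem_filter.1 hj).1, (Finset.mem_filter.1 hj).2⟩
  refine ⟨fun i hi => ?_, hex⟩
  obtain ⟨j, hj, hij⟩ := hex i hi
  exact hq.2.2.1 j i (rel.symm' hij)
    (coeff_negLogNumerator_ne_zero hρ hq.1.1 hm (Finsupp.mem_support_iff.1 hj)).1

theorem isLift_support_of_coeff_ne_zero (hρ : ∀ i, ρ (R.coroot i) = 1)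
    (hp : p ∈ R.symmetricPairs rel) (hq : q ∈ R.symmetricPairs rel)
    (hL : A.IsLeanLift rel p.2 L) (hm : coeff m (R.negLogNumerator ρ q) ≠ 0)
    (hmap : m.mapDomain (Quotient.mk rel) = liftExp R rel p L) (h2 : p.2 = q.2) :
    A.IsLift rel p.2 m.support :=
  ⟨fun _ hi => h2 ▸ (coeff_negLogNumerator_ne_zero hρ hq.1.1 hm (Finsupp.mem_support_iff.1 hi)).1,
    isConnected_support_of_coeff_negLogNumerator_ne_zero hρ hq.1.1 hm,
    (subset_of_coeff_ne_zero hρ hp hq hL hm hmap).2⟩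

open Classical in
theorem card_mul_label_le (hρ : ∀ i, ρ (R.coroot i) = 1) (hq : q ∈ R.symmetricPairs rel)
    (hm : coeff m (R.negLogNumerator ρ q) ≠ 0) (i : Fin n) :
    (m.support.filter (rel i ·)).card * R.label q i ≤ ∑ j ∈ m.support with rel i j, m j := by
  rw [← smul_eq_mul]
  refine Finset.card_nsmul_le_sum _ _ _ fun j hj => ?_
  rw [Finset.mem_filter] at hj
  rw [label_eq_of_rel hq hj.2]
  exact (coeff_negLogNumerator_ne_zero hρ hq.1.1 hm (Finsupp.mem_support_iff.1 hj.1)).2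

/-- Leanness enters here: the support of `m` has at least as many nodes in each class as `L` but the
same total, so the label of `q` there is no larger. -/
theorem label_le_of_coeff_ne_zero (hρ : ∀ i, ρ (R.coroot i) = 1)
    (hp : p ∈ R.symmetricPairs rel) (hq : q ∈ R.symmetricPairs rel)
    (hL : A.IsLeanLift rel p.2 L) (hm : coeff m (R.negLogNumerator ρ q) ≠ 0)
    (hmap : m.mapDomain (Quotient.mk rel) = liftExp R rel p L) (h2 : p.2 = q.2) :
    R.label q ≤ R.label p := by
  classical
  intro i
  by_cases hi : i ∈ p.2
  · have hle := hL.2 _ (isLift_support_of_coeff_ne_zero hρ hp hq hL hm hmap h2) i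
    rw [ncard_inter_class, ncard_inter_class] at hle
    have h := DFunLike.congr_fun hmap (Quotient.mk rel i)
    rw [mapDomain_mk_apply, liftExp_apply hp hL.1.1] at h
    refine Nat.le_of_mul_le_mul_left ?_ (card_class_pos hL hi)
    rw [← h]
    exact (Nat.mul_le_mul_right _ hle).trans (card_mul_label_le hρ hq hm i)
  · rw [label_eq_zero_iff.2 (h2 ▸ hi)]
    exact Nat.zero_le _

/-- With equal labels the chain of inequalities on each class is tight, so every nonzero entry takes
its least possible value. -/
theorem eq_filter_label_of_coeff_ne_zero (hρ : ∀ i, ρ (R.coroot i) = 1)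
    (hp : p ∈ R.symmetricPairs rel) (hq : q ∈ R.symmetricPairs rel)
    (hL : A.IsLeanLift rel p.2 L) (hm : coeff m (R.negLogNumerator ρ q) ≠ 0)
    (hmap : m.mapDomain (Quotient.mk rel) = liftExp R rel p L) (h : R.label q = R.label p) :
    m = (R.label q).filter (· ∈ m.support) := by
  classical
  have h2 : p.2 = q.2 := by
    ext i
    rw [← label_pos_iff (R := R), ← h, label_pos_iff]
  ext i
  by_cases hi : i ∈ m.support
  · rw [Finsupp.filter_apply_pos (· ∈ m.support) _ hi]
    have hle := hL.2 _ (isLift_support_of_coeff_ne_zero hρ hp hq hL hm hmap h2) i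
    rw [ncard_inter_class, ncard_inter_class] at hle
    have hs := DFunLike.congr_fun hmap (Quotient.mk rel i)
    rw [mapDomain_mk_apply, liftExp_apply hp hL.1.1, ← h] at hs
    have hmle : ∀ j ∈ m.support.filter (rel i ·), R.label q j ≤ m j := fun j hj =>
      (coeff_negLogNumerator_ne_zero hρ hq.1.1 hm
        (Finsupp.mem_support_iff.1 (Finset.mem_filter.1 hj).1)).2
    have hconst : ∑ j ∈ m.support.filter (rel i ·), R.label q j =
        (m.support.filter (rel i ·)).card * R.label q i := by
      rw [← smul_eq_mul]
      refine Finset.sum_eq_card_nsmul fun j hj => ?_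
      rw [label_eq_of_rel hq (Finset.mem_filter.1 hj).2]
    have heq : ∑ j ∈ m.support.filter (rel i ·), R.label q j =
        ∑ j ∈ m.support.filter (rel i ·), m j := by
      refine le_antisymm (Finset.sum_le_sum hmle) ?_
      rw [hs, hconst]
      exact Nat.mul_le_mul_right _ hle
    exact ((Finset.sum_eq_sum_iff_of_le hmle).1 heq i
      (Finset.mem_filter.2 ⟨hi, rel.refl' i⟩)).symm
  · rw [Finsupp.filter_apply_neg (· ∈ m.support) _ hi, Finsupp.notMem_support_iff.1 hi]

theorem exists_of_coeff_specialization_ne_zero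
    (hne : coeff (liftExp R rel p L) (GCM.specialization rel (R.negLogNumerator ρ q)) ≠ 0) :
    ∃ m : Fin n →₀ ℕ, coeff m (R.negLogNumerator ρ q) ≠ 0 ∧
      m.mapDomain (Quotient.mk rel) = liftExp R rel p L := by
  rw [GCM.specialization, coeff_rename] at hne
  obtain ⟨m, hm, hm0⟩ := Finset.exists_ne_zero_of_sum_ne_zero hne
  exact ⟨m, hm0, by simpa using hm⟩

/-- The diagonal entry: each exponent with a nonzero contribution is a label restricted to a lift,
hence contributes positively, and `L` itself is one of these lifts. -/
theorem coeff_specialization_pos (hρ : ∀ i, ρ (R.coroot i) = 1)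
    (hp : p ∈ R.symmetricPairs rel) (hq : q ∈ R.symmetricPairs rel)
    (hL : A.IsLeanLift rel p.2 L) (h : R.label q = R.label p) :
    0 < coeff (liftExp R rel p L) (GCM.specialization rel (R.negLogNumerator ρ q)) := by
  have h2 : p.2 = q.2 := by
    ext i
    rw [← label_pos_iff (R := R), ← h, label_pos_iff]
  have hLne : L.Nonempty := by
    obtain ⟨i, hi⟩ := hp.1.2.2
    obtain ⟨j, hj, -⟩ := hL.1.2.2 i hi
    exact ⟨j, hj⟩
  rw [GCM.specialization, coeff_rename]
  refine Finset.sum_pos' (fun m hm => ?_) ⟨(R.label q).filter (· ∈ L), ?_, ?_⟩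
  · by_cases hm0 : coeff m (R.negLogNumerator ρ q) = 0
    · exact hm0.ge
    · have hmap : m.mapDomain (Quotient.mk rel) = liftExp R rel p L := by simpa using hm
      have hlift := isLift_support_of_coeff_ne_zero hρ hp hq hL hm0 hmap h2
      rw [eq_filter_label_of_coeff_ne_zero hρ hp hq hL hm0 hmap h]
      refine (coeff_label_negLogNumerator_pos hρ hq.1.1 (fun i hi => h2 ▸ hlift.1 hi) ?_
        hlift.2.1).le
      obtain ⟨i, hi⟩ := hLne
      obtain ⟨j, hj, -⟩ := hlift.2.2 i (hL.1.1 hi)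
      exact ⟨j, hj⟩
  · rw [h]
    simp [liftExp]
  · exact coeff_label_negLogNumerator_pos hρ hq.1.1 (fun i hi => h2 ▸ hL.1.1 hi) hLne hL.1.2.1

end Comparison

/-- A rank function on labels: larger support first, then smaller total. -/
noncomputable def labelRank (d : Fin n →₀ ℕ) : ℕ ×ₗ ℕ := toLex (n - d.support.card, ∑ i, d i)

theorem labelRank_lt_of_coeff_specialization_ne_zero (hρ : ∀ i, ρ (R.coroot i) = 1)
    (hp : p ∈ R.symmetricPairs rel) (hq : q ∈ R.symmetricPairs rel) {L : Finset (Fin n)}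
    (hL : A.IsLeanLift rel p.2 L) (hlab : R.label q ≠ R.label p)
    (hne : coeff (liftExp R rel p L) (GCM.specialization rel (R.negLogNumerator ρ q)) ≠ 0) :
    labelRank (R.label q) < labelRank (R.label p) := by
  have hsupp : ∀ x : Dual ℂ 𝔥 × Set (Fin n), ((R.label x).support : Set (Fin n)) = x.2 := by
    intro x
    ext i
    rw [Finset.mem_coe, Finsupp.mem_support_iff, ← Nat.pos_iff_ne_zero, label_pos_iff]
  obtain ⟨m, hm, hmap⟩ := exists_of_coeff_specialization_ne_zero hne
  have hsub := (subset_of_coeff_ne_zero hρ hp hq hL hm hmap).1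
  rw [labelRank, labelRank, Prod.Lex.toLex_lt_toLex]
  by_cases h2 : p.2 = q.2
  · right
    have hs : (R.label q).support = (R.label p).support := by
      rw [← Finset.coe_inj, hsupp, hsupp, h2]
    refine ⟨by rw [hs], ?_⟩
    have hle := label_le_of_coeff_ne_zero hρ hp hq hL hm hmap h2
    obtain ⟨i, hi⟩ := Finsupp.ne_iff.1 hlab
    exact Finset.sum_lt_sum (fun j _ => hle j)
      ⟨i, Finset.mem_univ i, lt_of_le_of_ne (hle i) hi⟩
  · left
    have hss : (R.label p).support ⊂ (R.label q).support := by
      rw [← Finset.coe_ssubset, hsupp, hsupp]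
      exact lt_of_le_of_ne hsub h2
    have h1 := Finset.card_lt_card hss
    have h3 := Finset.card_le_univ (R.label q).support
    rw [Fintype.card_fin] at h3
    simp only
    omega

/-- Compare both sides at the test exponent of a label. Labels of smaller rank have equal
multiplicities by induction, other different labels do not contribute, and the diagonal entry is
nonzero. -/
theorem card_label_eq_of_sum_specialization_eq (hρ : ∀ i, ρ (R.coroot i) = 1) {r s : ℕ}
    {p : Fin r → Dual ℂ 𝔥 × Set (Fin n)} (hp : ∀ k, p k ∈ R.symmetricPairs rel)
    {q : Fin s → Dual ℂ 𝔥 × Set (Fin n)} (hq : ∀ k, q k ∈ R.symmetricPairs rel)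
    (h : ∑ k, GCM.specialization rel (R.negLogNumerator ρ (p k)) =
      ∑ k, GCM.specialization rel (R.negLogNumerator ρ (q k))) (d : Fin n →₀ ℕ) :
    (Finset.univ.filter fun k => R.label (p k) = d).card =
      (Finset.univ.filter fun k => R.label (q k) = d).card := by
  classical
  induction hN : labelRank d using WellFoundedLT.induction generalizing d with
  | _ N ih =>
  subst hN
  by_cases hd : ∃ x ∈ R.symmetricPairs rel, R.label x = d
  swap
  · rw [Finset.filter_eq_empty_iff.2 fun k _ hk => hd ⟨_, hp k, hk⟩,
      Finset.filter_eq_empty_iff.2 fun k _ hk => hd ⟨_, hq k, hk⟩, Finset.card_empty,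
      Finset.card_empty]
  obtain ⟨x, hx, rfl⟩ := hd
  obtain ⟨K, hK⟩ := hx.2.2.2
  obtain ⟨L, rfl⟩ : ∃ L : Finset (Fin n), (L : Set (Fin n)) = K := ⟨K.toFinset, by simp⟩
  set φ : Dual ℂ 𝔥 × Set (Fin n) → ℚ := fun y =>
    coeff (liftExp R rel x L) (GCM.specialization rel (R.negLogNumerator ρ y)) with hφ
  have hcongr : ∀ y ∈ R.symmetricPairs rel, ∀ z ∈ R.symmetricPairs rel, R.label y = R.label z →
      φ y = φ z := by
    intro y hy z hz hyz
    simp only [hφ, negLogNumerator_eq]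
    rw [weylNumerator_congr hρ hy.1.1 hz.1.1 ((approx_iff_label_eq hy.1.1 hz.1.1).2 hyz)]
  -- The test coefficient factors through the label; the value 0 at unattained labels is arbitrary.
  have hfun : ∃ F : (Fin n →₀ ℕ) → ℚ, ∀ y ∈ R.symmetricPairs rel, φ y = F (R.label y) := by
    refine ⟨fun e => if he : ∃ y ∈ R.symmetricPairs rel, R.label y = e then φ he.choose else 0,
      fun y hy => ?_⟩
    have he : ∃ z ∈ R.symmetricPairs rel, R.label z = R.label y := ⟨y, hy, rfl⟩
    simp only [dif_pos he]
    exact hcongr _ hy _ he.choose_spec.1 he.choose_spec.2.symm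
  obtain ⟨F, hF⟩ := hfun
  set T : Finset (Fin n →₀ ℕ) := insert (R.label x)
    (Finset.univ.image (fun k => R.label (p k)) ∪ Finset.univ.image fun k => R.label (q k)) with hT
  have hsum : ∀ {t : ℕ} (u : Fin t → Dual ℂ 𝔥 × Set (Fin n)),
      (∀ k, u k ∈ R.symmetricPairs rel) → (∀ k, R.label (u k) ∈ T) → ∑ k, φ (u k) =
        ∑ e ∈ T, ((Finset.univ.filter fun k => R.label (u k) = e).card : ℚ) * F e := by
    intro t u hu huT
    rw [← Finset.sum_fiberwise_of_maps_to (s := Finset.univ) (t := T) fun k _ => huT k]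
    refine Finset.sum_congr rfl fun e _ => ?_
    rw [← nsmul_eq_mul]
    refine Finset.sum_eq_card_nsmul fun k hk => ?_
    rw [hF _ (hu k), (Finset.mem_filter.1 hk).2]
  have h1 : ∑ k, φ (p k) = ∑ k, φ (q k) := by
    simp only [hφ, ← map_sum, h]
  rw [hsum p hp fun k => by simp [hT], hsum q hq fun k => by simp [hT], ← sub_eq_zero,
    ← Finset.sum_sub_distrib, Finset.sum_eq_single (R.label x)] at h1
  · have hpos : F (R.label x) ≠ 0 := by
      rw [← hF x hx]
      exact (coeff_specialization_pos hρ hx hx hK rfl).ne'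
    rw [← sub_mul] at h1
    exact_mod_cast sub_eq_zero.1 ((mul_eq_zero.1 h1).resolve_right hpos)
  · intro e _ he
    by_cases hy : ∃ y ∈ R.symmetricPairs rel, R.label y = e
    · obtain ⟨y, hy, rfl⟩ := hy
      by_cases h0 : φ y = 0
      · rw [← hF y hy, h0]; simp
      · rw [ih _ (labelRank_lt_of_coeff_specialization_ne_zero hρ hx hy hK he h0) _ rfl, sub_self]
    · rw [Finset.filter_eq_empty_iff.2 fun k _ hk => hy ⟨_, hp k, hk⟩,
        Finset.filter_eq_empty_iff.2 fun k _ hk => hy ⟨_, hq k, hk⟩]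
      simp
  · simp [hT]

end GCM.Realization

theorem mainTheorem5 {n : ℕ} (A : GCM n) (hA : A.Symmetrizable)
    {𝔥 : Type*} [AddCommGroup 𝔥] [Module ℂ 𝔥] (R : A.Realization 𝔥)
    (ρ : Module.Dual ℂ 𝔥) (hρ : ∀ i, ρ (R.coroot i) = 1)
    (rel : Setoid (Fin n)) (r s : ℕ)
    (p : Fin r → Module.Dual ℂ 𝔥 × Set (Fin n)) (hp : ∀ k, p k ∈ R.symmetricPairs rel)
    (q : Fin s → Module.Dual ℂ 𝔥 × Set (Fin n)) (hq : ∀ k, q k ∈ R.symmetricPairs rel) :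
    List.TFAE [
      ∑ k, R.negLogNumerator ρ (p k) = ∑ k, R.negLogNumerator ρ (q k),
      ∑ k, GCM.specialization rel (R.negLogNumerator ρ (p k)) =
        ∑ k, GCM.specialization rel (R.negLogNumerator ρ (q k)),
      ∃ h : r = s, ∃ σ : Equiv.Perm (Fin r),
        ∀ k, R.Approx (p k) (q (Fin.cast h (σ k)))] := by
  classical
  have hpairs : ∀ x ∈ R.symmetricPairs rel, x ∈ R.pairs := fun x hx => hx.1.1
  tfae_have 1 → 2 := by
    intro h
    rw [← map_sum, h, map_sum]
  tfae_have 2 → 3 := by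
    intro h
    have hcard := GCM.Realization.card_label_eq_of_sum_specialization_eq hρ hp hq h
    -- Equal multiplicities give bijections between the fibres of the two label maps; glued together
    -- they form the permutation.
    have E : ∀ d, {k // R.label (p k) = d} ≃ {k // R.label (q k) = d} := fun d =>
      Fintype.equivOfCardEq (by
        rw [Fintype.card_subtype, Fintype.card_subtype]
        exact hcard d)
    let e : Fin r ≃ Fin s := Equiv.ofFiberEquiv E
    have he : ∀ k, R.label (q (e k)) = R.label (p k) := fun k => Equiv.ofFiberEquiv_map E k
    have hrs : r = s := by simpa using Fintype.card_congr e
    subst hrs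
    refine ⟨rfl, e, fun k => ?_⟩
    rw [Fin.cast_eq_self]
    exact (GCM.Realization.approx_iff_label_eq (hpairs _ (hp k)) (hpairs _ (hq _))).2 (he k).symm
  tfae_have 3 → 1 := by
    rintro ⟨rfl, σ, hσ⟩
    rw [← Equiv.sum_comp σ fun k => R.negLogNumerator ρ (q k)]
    refine Finset.sum_congr rfl fun k _ => ?_
    rw [GCM.Realization.negLogNumerator_eq, GCM.Realization.negLogNumerator_eq,
      GCM.Realization.weylNumerator_congr hρ (hpairs _ (hp k)) (hpairs _ (hq _)) (hσ k)]
    rfl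
  tfae_finish
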